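/- Let $\mathcal V$ be a measurable space whose diagonal $\{(x,x)\}\subset\mathcal V^2$ is measurable, $\nu$ a non-atomic probability measure on $\mathcal V$, $\theta>0$, and let $m\ge1$, $J\ge1$ be integers. Let $P\sim\mathrm{DP}(\theta,\nu)$ be a Dirichlet process, that is, $P$ has the law of $\sum_{j\ge1}P_j\delta_{Y_j}$ with $P_j=V_j\prod_{i<j}(1-V_i)$, where $(V_i)_{i\ge1}$ are i.i.d. $\mathrm{Beta}(1,\theta)$ and, independently, $(Y_i)_{i\ge1}$ are i.i.d. with law $\nu$. Let $X_1,\dots,X_m,X_{m+1},X_{m+2}$ be, given $P$, i.i.d. with distribution $P$. Let $h:\mathcal V\to\{1,\dots,J\}$ be a perfectly random hash function, i.e. the random variables $(h(x))_{x\in\mathcal V}$ are i.i.d. uniform on $\{1,\dots,J\}$, drawn independently of the sample: the $h(X_i)$, $i\le m+2$, are random variables and, given $(X_1,\dots,X_{m+2})=(x_1,\dots,x_{m+2})$, the vector $(h(X_i))_{i\le m+2}$ has the law of $(h(x_i))_{i\le m+2}$ with $x$ fixed. For $r=1,2$ put $$f_{X_{m+r}}=\#\{i\le m: X_i=X_{m+r}\},\qquad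 C_{h(X_{m+r})}=\#\{i\le m: h(X_i)=h(X_{m+r})\}.$$ Write $(a)_{(n)}=\prod_{i=0}^{n-1}(a+i)$, and let any term containing $1/k!$ with a negative integer $k$ be $0$. For integers $c_1,c_2,l_1,l_2\ge0$ define \begin{align*} \mathrm{Den}(c_1,c_2)&=J\,\mathbb 1\{c_1=c_2=:c\}\frac{(\frac{\theta}{J})_{(c+2)}(\theta-\frac{\theta}{J})_{(m-c)}}{c!\,(m-c)!}\\ &\quad+J(J-1)\frac{(\frac{\theta}{J})_{(c_1+1)}(\frac{\theta}{J})_{(c_2+1)}(\theta-\frac{2\theta}{J})_{(m-c_1-c_2)}}{c_1!\,c_2!\,(m-c_1-c_2)!},\\ \mathrm{Num}(l_1,l_2,c_1,c_2)&=\mathbb 1\{l_1=l_2=:l,\ c_1=c_2=:c\}\frac{\theta(l+1)(\frac{\theta}{J})_{(c-l)}(\theta-\frac{\theta}{J})_{(m-c)}}{(c-l)!\,(m-c)!}\\ &\quad+\mathbb 1\{c_1=c_2=:c\}\frac{\theta^2(\frac{\theta}{J})_{(c-l_1-l_2)}(\theta-\frac{\theta}{J})_{(m-c)}}{J\,(c-l_1-l_2)!\,(m-c)!}\\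 &\quad+\frac{J-1}{J}\cdot\frac{\theta^2(\frac{\theta}{J})_{(c_1-l_1)}(\frac{\theta}{J})_{(c_2-l_2)}(\theta-\frac{2\theta}{J})_{(m-c_1-c_2)}}{(c_1-l_1)!\,(c_2-l_2)!\,(m-c_1-c_2)!}. \end{align*} Then $\Pr[C_{h(X_{m+1})}=c_1,\,C_{h(X_{m+2})}=c_2]\neq0$ if and only if $\mathrm{Den}(c_1,c_2)>0$, and in that case, for all integers $l_1,l_2\ge0$, $$\Pr[f_{X_{m+1}}=l_1,\ f_{X_{m+2}}=l_2\mid C_{h(X_{m+1})}=c_1,\ C_{h(X_{m+2})}=c_2]=\frac{\mathrm{Num}(l_1,l_2,c_1,c_2)}{\mathrm{Den}(c_1,c_2)}.$$ -/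

import Mathlib

open MeasureTheory ProbabilityTheory
open scoped ENNReal

namespace RangeQuery

section DirichletProcess

variable {V : Type*} [MeasurableSpace V]

/-- Stick-breaking weights: `P_j = V_j ∏_{i < j} (1 - V_i)` (indices start at `0`). -/
noncomputable def stickWeight (v : ℕ → ℝ) (j : ℕ) : ℝ :=
  v j * ∏ i ∈ Finset.range j, (1 - v i)

/-- The measure `∑_j P_j δ_{Y_j}` built from stick proportions `v` and locations `y`. -/
noncomputable def stickBreaking (p : (ℕ → ℝ) × (ℕ → V)) : Measure V :=
  Measure.sum fun j => ENNReal.ofReal (stickWeight p.1 j) • Measure.dirac (p.2 j)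

theorem measurable_stickBreaking :
    Measurable (stickBreaking : (ℕ → ℝ) × (ℕ → V) → Measure V) := by
  refine Measure.measurable_of_measurable_coe _ fun s hs => ?_
  have h : ∀ p : (ℕ → ℝ) × (ℕ → V), stickBreaking p s =
      ∑' j, ENNReal.ofReal (stickWeight p.1 j) * s.indicator 1 (p.2 j) := by
    intro p
    simp [stickBreaking, Measure.sum_apply _ hs, Measure.dirac_apply' _ hs]
  simp_rw [h]
  refine Measurable.tsum fun j => ?_
  refine Measurable.mul ?_ ?_
  · unfold stickWeight
    fun_prop
  · exact (measurable_one.indicator hs).comp (by fun_prop)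

/-- The Dirichlet process `DP(θ, ν)` (`θ > 0`, `ν` a probability measure), as the law on the space
of measures on `V` of `∑_j P_j δ_{Y_j}`, where the stick proportions are i.i.d. `Beta(1, θ)` and,
independently of them, the locations `Y_j` are i.i.d. with law `ν`. -/
noncomputable def dirichletProcess (θ : ℝ) (ν : Measure V) : Measure (Measure V) :=
  ((Measure.infinitePi fun _ : ℕ => betaMeasure 1 θ).prod
    (Measure.infinitePi fun _ : ℕ => ν)).map stickBreaking

end DirichletProcess

section Model

variable {Ω V : Type*} [MeasurableSpace Ω] [MeasurableSpace V] {ι : Type*} [Fintype ι]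

/-- The random variables `(X_i)` are, conditionally on the random measure `P`, i.i.d. with
distribution `P`: `Pr[P ∈ B, X_i ∈ A_i ∀ i] = E[1{P ∈ B} ∏ i, P(A_i)]`. -/
structure IsSampleFrom (μ : Measure Ω) (P : Ω → Measure V) (X : ι → Ω → V) : Prop where
  measurable : ∀ i, Measurable (X i)
  measurable_prior : Measurable P
  law : ∀ (B : Set (Measure V)) (A : ι → Set V), MeasurableSet B → (∀ i, MeasurableSet (A i)) →
    μ {ω | P ω ∈ B ∧ ∀ i, X i ω ∈ A i} = ∫⁻ ω in P ⁻¹' B, ∏ i, P ω (A i) ∂μ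

/-- A perfectly random hash function with `J` buckets: the random variables `(h(x))_{x ∈ V}`
are i.i.d. uniform on the `J` buckets. -/
structure IsPerfectlyRandomHash {J : ℕ} (μ : Measure Ω) (h : Ω → V → Fin J) : Prop where
  measurable : ∀ x, Measurable fun ω => h ω x
  uniform : ∀ x j, μ {ω | h ω x = j} = (J : ℝ≥0∞)⁻¹
  indep : iIndepFun (fun x ω => h ω x) μ

/-- The random hash function `h` is drawn independently of the sample `(X_i)`: given
`X = x`, the hashed values `(h(X_i))_i` are random variables distributed as `(h(x_i))_i` with `x`
held fixed. (When `V` is uncountable the evaluation map `(h, x) ↦ h(x)` is not measurable for the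
product sigma-algebras, so that independence has to be stated for the hashed values.) -/
structure IsDrawnIndependently {J : ℕ} (μ : Measure Ω) (h : Ω → V → Fin J) (X : ι → Ω → V) :
    Prop where
  measurable : ∀ i, Measurable fun ω => h ω (X i ω)
  law : ∀ (A : Set (ι → V)) (b : ι → Fin J), MeasurableSet A →
    μ {ω | (fun i => X i ω) ∈ A ∧ ∀ i, h ω (X i ω) = b i} =
      ∫⁻ ω in {ω | (fun i => X i ω) ∈ A}, μ {ω' | ∀ i, h ω' (X i ω) = b i} ∂μ

end Model

section Queries

variable {Ω V : Type*} {m J : ℕ}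

open Classical in
/-- `f_{X_{m+r+1}}`, for `r = 0, 1`: the number of `i ≤ m` with `X_i = X_{m+r+1}`. -/
noncomputable def freq (X : Fin (m + 2) → Ω → V) (r : Fin 2) (ω : Ω) : ℕ :=
  (Finset.univ.filter fun i : Fin m => X (Fin.castAdd 2 i) ω = X (Fin.natAdd m r) ω).card

/-- `C_{h(X_{m+r+1})}`, for `r = 0, 1`: the number of `i ≤ m` with `h(X_i) = h(X_{m+r+1})`. -/
def hashedFreq (h : Ω → V → Fin J) (X : Fin (m + 2) → Ω → V) (r : Fin 2) (ω : Ω) : ℕ :=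
  (Finset.univ.filter fun i : Fin m =>
    h ω (X (Fin.castAdd 2 i) ω) = h ω (X (Fin.natAdd m r) ω)).card

end Queries

section Formulas

/-- The rising factorial `(a)_{(n)} = a (a + 1) ⋯ (a + n - 1)`. -/
noncomputable def rising (a : ℝ) (n : ℕ) : ℝ := (ascPochhammer ℝ n).eval a

/-- `(a)_{(k)} / k!`, with the usual convention that `1 / k! = 0` for a negative integer `k`. -/
noncomputable def risingOverFactorial (a : ℝ) (k : ℤ) : ℝ :=
  if 0 ≤ k then rising a k.toNat / (k.toNat.factorial : ℝ) else 0

/-- The denominator of the posterior. -/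
noncomputable def Den (θ : ℝ) (J m c₁ c₂ : ℕ) : ℝ :=
  (if c₁ = c₂ then
      (J : ℝ) * (rising (θ / J) (c₁ + 2) / (c₁.factorial : ℝ)
        * risingOverFactorial (θ - θ / J) ((m : ℤ) - c₁))
    else 0)
  + (J : ℝ) * ((J : ℝ) - 1)
    * (rising (θ / J) (c₁ + 1) / (c₁.factorial : ℝ)
      * (rising (θ / J) (c₂ + 1) / (c₂.factorial : ℝ))
      * risingOverFactorial (θ - 2 * θ / J) ((m : ℤ) - c₁ - c₂))

/-- The numerator of the posterior. -/
noncomputable def Num (θ : ℝ) (J m l₁ l₂ c₁ c₂ : ℕ) : ℝ :=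
  (if l₁ = l₂ ∧ c₁ = c₂ then
      θ * ((l₁ : ℝ) + 1) * risingOverFactorial (θ / J) ((c₁ : ℤ) - l₁)
        * risingOverFactorial (θ - θ / J) ((m : ℤ) - c₁)
    else 0)
  + (if c₁ = c₂ then
      θ ^ 2 / (J : ℝ) * risingOverFactorial (θ / J) ((c₁ : ℤ) - l₁ - l₂)
        * risingOverFactorial (θ - θ / J) ((m : ℤ) - c₁)
    else 0)
  + ((J : ℝ) - 1) / (J : ℝ) * (θ ^ 2
    * risingOverFactorial (θ / J) ((c₁ : ℤ) - l₁)
    * risingOverFactorial (θ / J) ((c₂ : ℤ) - l₂)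
    * risingOverFactorial (θ - 2 * θ / J) ((m : ℤ) - c₁ - c₂))

end Formulas

end RangeQuery

/-! A sample from a Dirichlet process is a Blackwell–MacQueen urn sequence: after `n` draws the next
one is fresh from `ν` with probability `θ/(θ+n)` and otherwise repeats a uniformly chosen earlier
draw. As `ν` has no atoms, a fresh value is almost surely new, so its hash is uniform and
independent of the earlier buckets, while a repeated value keeps its bucket. Hence the pairs `(X_i,
h(X_i))` form an urn sequence with base measure `ν ⊗ Unif{1,…,J}`
(`IsDrawnIndependently.map_eq_polyaUrn`).

The urn law follows from mixed moments. Splitting off the first stick gives a recursion for `E ∏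
P(A_i)` over the set `T` of indices that hit the first atom. Rescaling by rising factorials and
reorganising the sum by the block of a chosen index yields the prediction rule `urnMoment_insert`,
which is also the recursion of the urn on boxes (`polyaUrn_pi`).

Urn sequences are written with the newest draw at index 0, so the two queries are the first two
draws and the `m` data points come after them. Given the queries, each later draw is sorted into
finitely many types. A type starts with weight `w_t = θ ρ(t) + (number of queries of type t)`, and
the counts are Dirichlet-multinomial: `m!/(θ+2)_(m) · ∏ (w_t)_(N_t)/N_t!` (`polyaUrn_typeCount`).

The summands of `Num` correspond to queries with equal values, with distinct values in one bucket,
and in distinct buckets. Those of `Den` correspond to equal and distinct buckets, with types given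
by buckets alone. Both joint laws carry the factor `posteriorFactor θ m`, which is positive and
cancels in the quotient. -/

namespace RangeQuery

/-! ### Rising factorials and Beta moments -/

theorem rising_zero (a : ℝ) : rising a 0 = 1 := by simp [rising]

theorem rising_succ (a : ℝ) (n : ℕ) : rising a (n + 1) = rising a n * (a + n) := by
  simp [rising, ascPochhammer_succ_eval]

theorem rising_pos {a : ℝ} (ha : 0 < a) (n : ℕ) : 0 < rising a n := ascPochhammer_pos n a ha

theorem rising_add (a : ℝ) (k n : ℕ) : rising a (k + n) = rising a k * rising (a + k) n := by
  induction n with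
  | zero => simp [rising_zero]
  | succ n ih => rw [← add_assoc, rising_succ, ih, rising_succ]; push_cast; ring

theorem Gamma_add_natCast {a : ℝ} (ha : 0 < a) (n : ℕ) :
    Real.Gamma (a + n) = rising a n * Real.Gamma a := by
  induction n with
  | zero => simp [rising_zero]
  | succ n ih =>
    push_cast
    rw [← add_assoc, Real.Gamma_add_one (by positivity), ih, rising_succ]
    ring

theorem beta_ratio {θ : ℝ} (hθ : 0 < θ) (k l : ℕ) :
    beta (1 + k) (θ + l) / beta 1 θ =
      k.factorial * θ * rising θ l / rising θ (k + l + 1) := by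
  have hG := (Real.Gamma_pos_of_pos hθ).ne'
  have hr := (rising_pos hθ (k + l + 1)).ne'
  have h1 : Real.Gamma (1 + k : ℝ) = k.factorial := by
    rw [add_comm]; exact Real.Gamma_nat_eq_factorial k
  have h2 : (1 + k + (θ + l) : ℝ) = θ + ((k + l + 1 : ℕ) : ℝ) := by push_cast; ring
  rw [beta, beta, h1, h2, Gamma_add_natCast hθ, Gamma_add_natCast hθ, add_comm (1 : ℝ) θ,
    Real.Gamma_add_one hθ.ne', Real.Gamma_one]
  field_simp

/-- The integrand times the `Beta(1, θ)` density is an unnormalised `Beta(1 + k, θ + l)` density, so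
the integral is a ratio of Beta constants. -/
theorem lintegral_pow_mul_pow_betaMeasure {θ : ℝ} (hθ : 0 < θ) (k l : ℕ) :
    ∫⁻ v, ENNReal.ofReal v ^ k * ENNReal.ofReal (1 - v) ^ l ∂betaMeasure 1 θ =
      ENNReal.ofReal (k.factorial * θ * rising θ l / rising θ (k + l + 1)) := by
  have hm : Measurable (betaPDF 1 θ) := (measurable_betaPDFReal 1 θ).ennreal_ofReal
  have hm' : Measurable (betaPDF (1 + k) (θ + l)) :=
    (measurable_betaPDFReal _ _).ennreal_ofReal
  have hb := beta_pos one_pos hθ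
  have hb' : 0 < beta (1 + k) (θ + l) := beta_pos (by positivity) (by positivity)
  have hpt : ∀ v, (betaPDF 1 θ * fun v => ENNReal.ofReal v ^ k * ENNReal.ofReal (1 - v) ^ l) v =
      ENNReal.ofReal (beta (1 + k) (θ + l) / beta 1 θ) * betaPDF (1 + k) (θ + l) v := by
    intro v
    by_cases hv : 0 < v ∧ v < 1
    · have hv1 : 0 < 1 - v := by linarith [hv.2]
      rw [Pi.mul_apply, betaPDF_of_pos_lt_one hv.1 hv.2, betaPDF_of_pos_lt_one hv.1 hv.2,
        ← ENNReal.ofReal_pow hv.1.le, ← ENNReal.ofReal_pow hv1.le,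
        ← ENNReal.ofReal_mul (by have := hv.1; positivity),
        ← ENNReal.ofReal_mul (by have := hv.1; positivity),
        ← ENNReal.ofReal_mul (by positivity)]
      congr 1
      have e1 : v ^ ((1 : ℝ) + k - 1) = v ^ k := by
        rw [add_sub_cancel_left, Real.rpow_natCast]
      have e2 : (1 - v) ^ (θ + l - 1) = (1 - v) ^ (θ - 1) * (1 - v) ^ l := by
        rw [← Real.rpow_natCast (1 - v) l, ← Real.rpow_add hv1]; congr 1; ring
      rw [e1, e2]
      simp only [sub_self, Real.rpow_zero]
      field_simp
    · simp [betaPDF_eq, hv]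
  rw [betaMeasure, lintegral_withDensity_eq_lintegral_mul _ hm (by fun_prop), lintegral_congr hpt,
    lintegral_const_mul _ hm', lintegral_betaPDF_eq_one (by positivity) (by positivity), mul_one,
    beta_ratio hθ]

theorem ae_betaMeasure_mem {α β : ℝ} : ∀ᵐ v ∂betaMeasure α β, 0 ≤ v ∧ v ≤ 1 := by
  have hm : Measurable (betaPDF α β) := (measurable_betaPDFReal _ _).ennreal_ofReal
  rw [betaMeasure, ae_withDensity_iff hm]
  refine Filter.Eventually.of_forall fun v hv => ?_
  constructor
  · by_contra h
    exact hv (betaPDF_eq_zero_of_nonpos (by linarith))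
  · by_contra h
    exact hv (betaPDF_eq_zero_of_one_le (by linarith))

/-! ### Splitting off the first term of an i.i.d. sequence -/

/-- The sequence `a, s 0, s 1, …`. -/
def seqCons {α : Type*} (a : α) (s : ℕ → α) : ℕ → α := fun n => Nat.casesOn n a s

@[simp] theorem seqCons_zero {α : Type*} (a : α) (s : ℕ → α) : seqCons a s 0 = a := rfl
@[simp] theorem seqCons_succ {α : Type*} (a : α) (s : ℕ → α) (n : ℕ) :
    seqCons a s (n + 1) = s n := rfl

theorem measurable_seqCons {α : Type*} [MeasurableSpace α] :
    Measurable fun p : α × (ℕ → α) => seqCons p.1 p.2 := by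
  refine measurable_pi_iff.2 fun n => ?_
  cases n with
  | zero => exact measurable_fst
  | succ n => simp only [seqCons_succ]; fun_prop

theorem map_seqCons_infinitePi {α : Type*} [MeasurableSpace α] (μ : Measure α)
    [IsProbabilityMeasure μ] :
    (μ.prod (Measure.infinitePi fun _ : ℕ => μ)).map (fun p => seqCons p.1 p.2) =
      Measure.infinitePi fun _ : ℕ => μ := by
  refine Measure.eq_infinitePi _ fun s t ht => ?_
  -- The nonzero coordinates of `s`, shifted down so as to index the tail; coordinate 0 is
  -- constrained only when `0 ∈ s`.
  set s' : Finset ℕ := s.preimage Nat.succ (Nat.succ_injective.injOn) with hs'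
  have hprod : ∀ f : ℕ → ℝ≥0∞, ∏ i ∈ s, f i =
      (if 0 ∈ s then f 0 else 1) * ∏ i ∈ s', f (i + 1) := by
    intro f
    have he : s.erase 0 = s'.map ⟨Nat.succ, Nat.succ_injective⟩ := by
      ext i
      cases i with
      | zero => simp
      | succ i => simp [hs']
    have h2 : ∏ i ∈ s.erase 0, f i = ∏ i ∈ s', f (i + 1) := by
      rw [he, Finset.prod_map]; rfl
    split_ifs with h
    · rw [← h2, Finset.mul_prod_erase s f h]
    · rw [← h2, Finset.erase_eq_of_notMem h, one_mul]
  have hpre : (fun p : α × (ℕ → α) => seqCons p.1 p.2) ⁻¹' Set.pi s t =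
      (if 0 ∈ s then t 0 else Set.univ) ×ˢ Set.pi s' fun i => t (i + 1) := by
    ext p
    simp only [Set.mem_preimage, Set.mem_pi, Set.mem_prod]
    constructor
    · intro h
      refine ⟨?_, fun i hi => h (i + 1) (by simpa [hs'] using hi)⟩
      split_ifs with h0
      · exact h 0 h0
      · trivial
    · rintro ⟨h0, h⟩ i hi
      cases i with
      | zero => simpa [show 0 ∈ s from hi] using h0
      | succ i => exact h i (by simpa [hs'] using hi)
  rw [Measure.map_apply measurable_seqCons
    (MeasurableSet.pi (Finset.countable_toSet s) fun i _ => ht i), hpre, Measure.prod_prod,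
    Measure.infinitePi_pi _ (fun i _ => ht _), hprod]
  congr 1
  split_ifs <;> simp

/-! ### Self-similarity of the stick-breaking measure -/

section StickBreaking

variable {V : Type*} [MeasurableSpace V]

theorem stickWeight_zero (v : ℕ → ℝ) : stickWeight v 0 = v 0 := by simp [stickWeight]

theorem stickWeight_seqCons_succ (a : ℝ) (v : ℕ → ℝ) (j : ℕ) :
    stickWeight (seqCons a v) (j + 1) = (1 - a) * stickWeight v j := by
  simp only [stickWeight, Finset.prod_range_succ', seqCons_succ, seqCons_zero]
  ring

/-- What remains after the first break is a scaled stick-breaking measure. The bound `a ≤ 1` lets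
`ENNReal.ofReal` split the products `(1 - a) * P_j`. -/
theorem stickBreaking_seqCons {a : ℝ} (ha : a ≤ 1) (b : V) (v : ℕ → ℝ) (y : ℕ → V) :
    stickBreaking (seqCons a v, seqCons b y) =
      ENNReal.ofReal a • Measure.dirac b + ENNReal.ofReal (1 - a) • stickBreaking (v, y) := by
  ext s hs
  simp only [stickBreaking, Measure.sum_apply _ hs, Measure.smul_apply, Measure.add_apply,
    smul_eq_mul]
  rw [tsum_eq_zero_add' ENNReal.summable, ← ENNReal.tsum_mul_left]
  simp only [seqCons_succ, seqCons_zero, stickWeight_seqCons_succ, stickWeight_zero]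
  congr 2
  ext j
  rw [ENNReal.ofReal_mul (by linarith), mul_assoc]

theorem sum_range_stickWeight (v : ℕ → ℝ) (n : ℕ) :
    ∑ j ∈ Finset.range n, stickWeight v j = 1 - ∏ i ∈ Finset.range n, (1 - v i) := by
  induction n with
  | zero => simp
  | succ n ih => rw [Finset.sum_range_succ, ih, Finset.prod_range_succ, stickWeight]; ring

/-- The partial sums of the weights telescope to `1 - ∏ (1 - v i)`. The bound keeps the moments
finite; the almost sure total mass 1 is not needed. -/
theorem stickBreaking_apply_le_one {v : ℕ → ℝ} (hv : ∀ i, 0 ≤ v i ∧ v i ≤ 1) (y : ℕ → V)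
    (s : Set V) : stickBreaking (v, y) s ≤ 1 := by
  refine (measure_mono (Set.subset_univ s)).trans ?_
  have hp : ∀ n, 0 ≤ ∏ i ∈ Finset.range n, (1 - v i) := fun n =>
    Finset.prod_nonneg fun i _ => by linarith [(hv i).2]
  simp only [stickBreaking, Measure.sum_apply _ MeasurableSet.univ, Measure.smul_apply,
    measure_univ, smul_eq_mul, mul_one]
  refine ENNReal.summable.tsum_le_of_sum_range_le fun n => ?_
  rw [← ENNReal.ofReal_sum_of_nonneg (f := stickWeight v) fun j _ => mul_nonneg (hv j).1 (hp j),
    sum_range_stickWeight]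
  exact ENNReal.ofReal_le_one.2 (by linarith [hp n])

end StickBreaking

theorem prod_indicator_one_eq {V ι : Type*} (A : ι → Set V) (T : Finset ι) (y : V) :
    ∏ i ∈ T, (A i).indicator (1 : V → ℝ≥0∞) y = (⋂ i ∈ T, A i).indicator 1 y := by
  classical
  by_cases h : ∀ i ∈ T, y ∈ A i
  · rw [Set.indicator_of_mem (by simpa using h),
      Finset.prod_congr rfl fun i hi => Set.indicator_of_mem (h i hi) _]
    simp
  · rw [Set.indicator_of_notMem (by simpa using h)]
    push Not at h
    obtain ⟨i, hi, hy⟩ := h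
    exact Finset.prod_eq_zero hi (Set.indicator_of_notMem hy _)

/-! ### Mixed moments of the Dirichlet process and the prediction rule -/

section Moments

variable {V : Type*} [MeasurableSpace V] {ι : Type*}

/-- `E[∏_{i ∈ S} P(A_i)]` for a Dirichlet process `P`. -/
noncomputable def dpMoment (θ : ℝ) (ν : Measure V) (A : ι → Set V) (S : Finset ι) : ℝ≥0∞ :=
  ∫⁻ Q, ∏ i ∈ S, Q (A i) ∂(dirichletProcess θ ν)

/-- The moments of the Dirichlet process, normalised by the rising factorial. -/
noncomputable def urnMoment (θ : ℝ) (ν : Measure V) (A : ι → Set V) (S : Finset ι) : ℝ :=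
  rising θ S.card * (dpMoment θ ν A S).toReal

theorem urnMoment_congr {θ : ℝ} {ν : Measure V} {A B : ι → Set V} {S : Finset ι} (h : ∀ i ∈ S, A i = B i) :
    urnMoment θ ν A S = urnMoment θ ν B S := by
  simp only [urnMoment, dpMoment]
  congr 3
  ext Q
  exact Finset.prod_congr rfl fun i hi => by rw [h i hi]

theorem lintegral_infinitePi_seqCons {α : Type*} [MeasurableSpace α] (μ : Measure α)
    [IsProbabilityMeasure μ] {F : (ℕ → α) → ℝ≥0∞} (hF : Measurable F) :
    ∫⁻ s, F s ∂(Measure.infinitePi fun _ : ℕ => μ) =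
      ∫⁻ a, ∫⁻ s, F (seqCons a s) ∂(Measure.infinitePi fun _ : ℕ => μ) ∂μ := by
  conv_lhs => rw [← map_seqCons_infinitePi μ]
  rw [lintegral_map hF measurable_seqCons,
    lintegral_prod (fun p : α × (ℕ → α) => F (seqCons p.1 p.2))
      (hF.comp measurable_seqCons).aemeasurable]

theorem measurable_prod_apply {A : ι → Set V} (hA : ∀ i, MeasurableSet (A i)) (S : Finset ι) :
    Measurable fun Q : Measure V => ∏ i ∈ S, Q (A i) :=
  Finset.measurable_fun_prod _ fun i _ => Measure.measurable_coe (hA i)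

theorem measurable_prod_stickBreaking {A : ι → Set V} (hA : ∀ i, MeasurableSet (A i))
    (S : Finset ι) : Measurable fun p : (ℕ → ℝ) × (ℕ → V) => ∏ i ∈ S, stickBreaking p (A i) :=
  (measurable_prod_apply hA S).comp measurable_stickBreaking

theorem ae_infinitePi_betaMeasure_mem {α β : ℝ} (hα : 0 < α) (hβ : 0 < β) :
    ∀ᵐ v ∂(Measure.infinitePi fun _ : ℕ => betaMeasure α β), ∀ i, 0 ≤ v i ∧ v i ≤ 1 := by
  have := isProbabilityMeasureBeta hα hβ
  rw [ae_all_iff]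
  intro i
  exact (measurePreserving_eval_infinitePi (fun _ : ℕ => betaMeasure α β) i).quasiMeasurePreserving.ae
    ae_betaMeasure_mem

variable {θ : ℝ} {ν : Measure V} [IsProbabilityMeasure ν] {A : ι → Set V}

theorem isProbabilityMeasure_dirichletProcess (hθ : 0 < θ) :
    IsProbabilityMeasure (dirichletProcess θ ν) := by
  have := isProbabilityMeasureBeta one_pos hθ
  exact Measure.isProbabilityMeasure_map measurable_stickBreaking.aemeasurable

theorem dpMoment_eq (hθ : 0 < θ) (hA : ∀ i, MeasurableSet (A i)) (S : Finset ι) :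
    dpMoment θ ν A S =
      ∫⁻ v, ∫⁻ y, ∏ i ∈ S, stickBreaking (v, y) (A i) ∂(Measure.infinitePi fun _ : ℕ => ν)
        ∂(Measure.infinitePi fun _ : ℕ => betaMeasure 1 θ) := by
  have := isProbabilityMeasureBeta one_pos hθ
  rw [dpMoment, dirichletProcess, lintegral_map (measurable_prod_apply hA S)
    measurable_stickBreaking, lintegral_prod _ (measurable_prod_stickBreaking hA S).aemeasurable]

theorem dpMoment_le_one (hθ : 0 < θ) (hA : ∀ i, MeasurableSet (A i)) (S : Finset ι) :
    dpMoment θ ν A S ≤ 1 := by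
  have := isProbabilityMeasureBeta one_pos hθ
  rw [dpMoment_eq hθ hA]
  have : ∀ᵐ v ∂(Measure.infinitePi fun _ : ℕ => betaMeasure 1 θ),
      ∫⁻ y, ∏ i ∈ S, stickBreaking (v, y) (A i) ∂(Measure.infinitePi fun _ : ℕ => ν) ≤ 1 := by
    filter_upwards [ae_infinitePi_betaMeasure_mem one_pos hθ] with v hv
    calc _ ≤ ∫⁻ _, 1 ∂(Measure.infinitePi fun _ : ℕ => ν) := lintegral_mono fun y =>
            Finset.prod_le_one' fun i _ => stickBreaking_apply_le_one hv y _
      _ = 1 := by simp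
  calc _ ≤ ∫⁻ _, 1 ∂(Measure.infinitePi fun _ : ℕ => betaMeasure 1 θ) := lintegral_mono_ae this
    _ = 1 := by simp

/-- Conditioning on the first atom of the stick-breaking representation, where `T` is the set of
indices that hit this atom. -/
theorem dpMoment_eq_sum [DecidableEq ι] (hθ : 0 < θ) (hA : ∀ i, MeasurableSet (A i))
    (S : Finset ι) :
    dpMoment θ ν A S = ∑ T ∈ S.powerset,
      ENNReal.ofReal (T.card.factorial * θ * rising θ (S \ T).card /
        rising θ (T.card + (S \ T).card + 1)) *
      (ν (⋂ i ∈ T, A i) * dpMoment θ ν A (S \ T)) := by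
  have := isProbabilityMeasureBeta one_pos hθ
  have hmF := measurable_prod_stickBreaking hA
  have hcons : ∀ v₀ : ℝ, v₀ ≤ 1 → ∀ (v : ℕ → ℝ) (y₀ : V) (y : ℕ → V),
      ∏ i ∈ S, stickBreaking (seqCons v₀ v, seqCons y₀ y) (A i) = ∑ T ∈ S.powerset,
        (ENNReal.ofReal v₀ ^ T.card * ENNReal.ofReal (1 - v₀) ^ (S \ T).card) *
          ((⋂ i ∈ T, A i).indicator 1 y₀ * ∏ i ∈ S \ T, stickBreaking (v, y) (A i)) := by
    intro v₀ hv₀ v y₀ y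
    simp_rw [stickBreaking_seqCons hv₀, Measure.add_apply, Measure.smul_apply,
      Measure.dirac_apply' _ (hA _), smul_eq_mul]
    -- Expanding the product chooses, for each index, the first atom (`i ∈ T`) or the remaining
    -- measure.
    rw [Finset.prod_add]
    refine Finset.sum_congr rfl fun T _ => ?_
    rw [Finset.prod_mul_distrib, Finset.prod_mul_distrib, Finset.prod_const, Finset.prod_const,
      prod_indicator_one_eq]
    ring
  have hy : ∀ v₀ : ℝ, v₀ ≤ 1 → ∀ v : ℕ → ℝ,
      ∫⁻ y, ∏ i ∈ S, stickBreaking (seqCons v₀ v, y) (A i) ∂(Measure.infinitePi fun _ : ℕ => ν) =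
      ∑ T ∈ S.powerset,
        (ENNReal.ofReal v₀ ^ T.card * ENNReal.ofReal (1 - v₀) ^ (S \ T).card) *
          (ν (⋂ i ∈ T, A i) * ∫⁻ y, ∏ i ∈ S \ T, stickBreaking (v, y) (A i)
            ∂(Measure.infinitePi fun _ : ℕ => ν)) := by
    intro v₀ hv₀ v
    have hm1 : ∀ T : Finset ι, Measurable fun y : ℕ → V =>
        ∏ i ∈ T, stickBreaking (v, y) (A i) := fun T => (hmF T).comp (by fun_prop)
    have hmi : ∀ T : Finset ι, MeasurableSet (⋂ i ∈ T, A i) := fun T =>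
      T.measurableSet_biInter fun i _ => hA i
    have hm0 : Measurable fun y : ℕ → V =>
        ∏ i ∈ S, stickBreaking (seqCons v₀ v, y) (A i) := (hmF S).comp (by fun_prop)
    rw [lintegral_infinitePi_seqCons ν hm0]
    simp_rw [hcons v₀ hv₀]
    have h1 : ∀ y₀ : V, ∫⁻ y, ∑ T ∈ S.powerset,
        (ENNReal.ofReal v₀ ^ T.card * ENNReal.ofReal (1 - v₀) ^ (S \ T).card) *
          ((⋂ i ∈ T, A i).indicator 1 y₀ * ∏ i ∈ S \ T, stickBreaking (v, y) (A i))
            ∂(Measure.infinitePi fun _ : ℕ => ν) = ∑ T ∈ S.powerset,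
        (ENNReal.ofReal v₀ ^ T.card * ENNReal.ofReal (1 - v₀) ^ (S \ T).card) *
          ((⋂ i ∈ T, A i).indicator 1 y₀ * ∫⁻ y, ∏ i ∈ S \ T, stickBreaking (v, y) (A i)
            ∂(Measure.infinitePi fun _ : ℕ => ν)) := by
      intro y₀
      rw [lintegral_finsetSum _ fun T _ => ((hm1 _).const_mul _).const_mul _]
      refine Finset.sum_congr rfl fun T _ => ?_
      rw [lintegral_const_mul _ ((hm1 _).const_mul _), lintegral_const_mul _ (hm1 _)]
    simp_rw [h1]
    rw [lintegral_finsetSum _ fun T _ =>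
      ((measurable_one.indicator (hmi T)).mul_const _).const_mul _]
    refine Finset.sum_congr rfl fun T _ => ?_
    rw [lintegral_const_mul _ ((measurable_one.indicator (hmi T)).mul_const _),
      lintegral_mul_const _ (measurable_one.indicator (hmi T)), lintegral_indicator_one (hmi T)]
  have hm2 : ∀ T : Finset ι, Measurable fun v : ℕ → ℝ =>
      ∫⁻ y, ∏ i ∈ T, stickBreaking (v, y) (A i) ∂(Measure.infinitePi fun _ : ℕ => ν) :=
    fun T => (hmF T).lintegral_prod_right'
  rw [dpMoment_eq hθ hA, lintegral_infinitePi_seqCons _ (hm2 S)]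
  -- Only almost everywhere, because the self-similarity needs `v₀ ≤ 1`.
  have hv : ∀ᵐ v₀ ∂betaMeasure 1 θ,
      ∫⁻ v, ∫⁻ y, ∏ i ∈ S, stickBreaking (seqCons v₀ v, y) (A i)
        ∂(Measure.infinitePi fun _ : ℕ => ν) ∂(Measure.infinitePi fun _ : ℕ => betaMeasure 1 θ) =
      ∑ T ∈ S.powerset,
        (ENNReal.ofReal v₀ ^ T.card * ENNReal.ofReal (1 - v₀) ^ (S \ T).card) *
          (ν (⋂ i ∈ T, A i) * dpMoment θ ν A (S \ T)) := by
    filter_upwards [ae_betaMeasure_mem] with v₀ hv₀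
    simp_rw [hy v₀ hv₀.2]
    rw [lintegral_finsetSum _ fun T _ => ((hm2 _).const_mul _).const_mul _]
    refine Finset.sum_congr rfl fun T _ => ?_
    rw [lintegral_const_mul _ ((hm2 _).const_mul _), lintegral_const_mul _ (hm2 _),
      dpMoment_eq hθ hA]
  rw [lintegral_congr_ae hv, lintegral_finsetSum _ fun T _ => by fun_prop]
  refine Finset.sum_congr rfl fun T _ => ?_
  rw [lintegral_mul_const _ (by fun_prop), lintegral_pow_mul_pow_betaMeasure hθ]

/-- In `dpMoment_eq_sum` the term `T = ∅` is the moment of `S` itself with coefficient `θ/(θ +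
|S|)`. Moving it to the left leaves `|S|/(θ + |S|)`, and the rising factorials in `urnMoment` clear
the other denominators. -/
theorem card_mul_urnMoment [DecidableEq ι] (hθ : 0 < θ) (hA : ∀ i, MeasurableSet (A i))
    (S : Finset ι) :
    S.card * urnMoment θ ν A S = ∑ T ∈ S.powerset.erase ∅,
      θ * T.card.factorial * ν.real (⋂ i ∈ T, A i) * urnMoment θ ν A (S \ T) := by
  have hfin : ∀ S, dpMoment θ ν A S ≠ ∞ := fun S =>
    ne_top_of_le_ne_top ENNReal.one_ne_top (dpMoment_le_one hθ hA S)
  have key := congrArg ENNReal.toReal (dpMoment_eq_sum (ν := ν) hθ hA S)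
  rw [ENNReal.toReal_sum fun T _ => ENNReal.mul_ne_top ENNReal.ofReal_ne_top
    (ENNReal.mul_ne_top (measure_ne_top _ _) (hfin _))] at key
  have hr := rising_pos hθ
  have hterm : ∀ T ∈ S.powerset, (ENNReal.ofReal (T.card.factorial * θ * rising θ (S \ T).card /
        rising θ (T.card + (S \ T).card + 1)) *
      (ν (⋂ i ∈ T, A i) * dpMoment θ ν A (S \ T))).toReal =
      (θ * T.card.factorial * ν.real (⋂ i ∈ T, A i) * urnMoment θ ν A (S \ T)) /
        rising θ (S.card + 1) := by
    intro T hT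
    have hc : T.card + (S \ T).card = S.card := by
      rw [add_comm, Finset.card_sdiff_add_card_eq_card (Finset.mem_powerset.1 hT)]
    rw [ENNReal.toReal_mul, ENNReal.toReal_mul, hc, ENNReal.toReal_ofReal
      (div_nonneg (mul_nonneg (by positivity) (hr _).le) (hr _).le), urnMoment, Measure.real]
    ring
  rw [Finset.sum_congr rfl hterm, ← Finset.sum_div,
    ← Finset.add_sum_erase _ _ (Finset.empty_mem_powerset S)] at key
  have h0 : (dpMoment θ ν A S).toReal = urnMoment θ ν A S / rising θ S.card := by
    rw [urnMoment, mul_div_cancel_left₀ _ (hr _).ne']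
  rw [h0, rising_succ] at key
  have h1 := (hr S.card).ne'
  have h2 : θ + S.card ≠ 0 := by positivity
  simp only [Finset.card_empty, Nat.factorial_zero, Nat.cast_one, mul_one, Finset.notMem_empty,
    Set.iInter_of_empty, Set.iInter_univ, probReal_univ, Finset.sdiff_empty] at key
  generalize ∑ T ∈ S.powerset.erase ∅, θ * T.card.factorial * ν.real (⋂ i ∈ T, A i) *
    urnMoment θ ν A (S \ T) = R at key ⊢
  field_simp at key
  linarith

theorem urnMoment_empty (hθ : 0 < θ) : urnMoment θ ν A ∅ = 1 := by
  have := isProbabilityMeasure_dirichletProcess (ν := ν) hθ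
  simp [urnMoment, dpMoment, rising_zero]

/-- Conditioning on the set `T` of indices with the same value as a given index `a`. -/
theorem urnMoment_eq_sum [DecidableEq ι] (hθ : 0 < θ) (hA : ∀ i, MeasurableSet (A i))
    (S : Finset ι) {a : ι} (ha : a ∈ S) :
    urnMoment θ ν A S = ∑ T ∈ S.powerset with a ∈ T,
      θ * (T.card - 1).factorial * ν.real (⋂ i ∈ T, A i) * urnMoment θ ν A (S \ T) := by
  induction hn : S.card using Nat.strong_induction_on generalizing S with
  | _ n ih =>
  have hn0 : (S.card : ℝ) ≠ 0 := by
    exact_mod_cast (Finset.card_pos.2 ⟨a, ha⟩).ne'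
  -- After multiplication by `|S|`, the sum runs over all nonempty blocks `T`. When `a ∉ T`, the
  -- induction hypothesis expands the moment of `S \ T` by the block `T'` of `a`; summing over `T`
  -- first returns `|S \ T'|` times the moment of `S \ T'`. The coefficients combine as `|T'|! +
  -- (|T'|-1)! |S \ T'| = |S| (|T'|-1)!`.
  refine mul_left_cancel₀ hn0 ?_
  rw [card_mul_urnMoment hθ hA]
  have hsplit : S.powerset.erase ∅ = (S.powerset.filter fun T => a ∈ T) ∪
      ((S.powerset.erase ∅).filter fun T => a ∉ T) := by
    ext T
    by_cases h : a ∈ T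
    · simp [h, Finset.ne_empty_of_mem h]
    · simp [h]
  have hdisj : Disjoint (S.powerset.filter fun T => a ∈ T)
      ((S.powerset.erase ∅).filter fun T => a ∉ T) := by
    rw [Finset.disjoint_left]
    intro T h h'
    exact (Finset.mem_filter.1 h').2 (Finset.mem_filter.1 h).2
  rw [hsplit, Finset.sum_union hdisj]
  have h2 : ∑ T ∈ (S.powerset.erase ∅) with a ∉ T,
      θ * T.card.factorial * ν.real (⋂ i ∈ T, A i) * urnMoment θ ν A (S \ T) =
      ∑ T' ∈ S.powerset with a ∈ T',
        θ * (T'.card - 1).factorial * ν.real (⋂ i ∈ T', A i) *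
          ((S \ T').card * urnMoment θ ν A (S \ T')) := by
    have hl : ∀ T ∈ (S.powerset.erase ∅).filter fun T => a ∉ T,
        θ * T.card.factorial * ν.real (⋂ i ∈ T, A i) * urnMoment θ ν A (S \ T) =
        ∑ T' ∈ (S \ T).powerset with a ∈ T',
          θ * T.card.factorial * ν.real (⋂ i ∈ T, A i) *
            (θ * (T'.card - 1).factorial * ν.real (⋂ i ∈ T', A i) *
              urnMoment θ ν A ((S \ T) \ T')) := by
      intro T hT
      simp only [Finset.mem_filter, Finset.mem_erase, Finset.mem_powerset] at hT
      have hlt : (S \ T).card < n := by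
        rw [← hn]
        refine Finset.card_lt_card (Finset.sdiff_ssubset hT.1.2 ?_)
        exact Finset.nonempty_iff_ne_empty.2 hT.1.1
      rw [ih _ hlt (S \ T) (Finset.mem_sdiff.2 ⟨ha, hT.2⟩) rfl, Finset.mul_sum]
    rw [Finset.sum_congr rfl hl]
    simp_rw [card_mul_urnMoment hθ hA, Finset.mul_sum]
    rw [Finset.sum_comm' (t' := S.powerset.filter fun T' => a ∈ T')
      (s' := fun T' => (S \ T').powerset.erase ∅)]
    · refine Finset.sum_congr rfl fun T' _ => Finset.sum_congr rfl fun T _ => ?_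
      rw [sdiff_sdiff_comm]
      ring
    · intro T T'
      simp only [Finset.mem_filter, Finset.mem_erase, Finset.mem_powerset, Finset.subset_sdiff]
      constructor
      · rintro ⟨⟨⟨h1, h2⟩, h3⟩, ⟨h4, h5⟩, h6⟩
        exact ⟨⟨h1, h2, h5.symm⟩, h4, h6⟩
      · rintro ⟨⟨h1, h2, h3⟩, h4, h5⟩
        exact ⟨⟨⟨h1, h2⟩, fun h => Finset.disjoint_left.1 h3 h h5⟩, ⟨h4, h3.symm⟩, h5⟩
  rw [h2, Finset.mul_sum, ← Finset.sum_add_distrib]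
  refine Finset.sum_congr rfl fun T hT => ?_
  simp only [Finset.mem_filter, Finset.mem_powerset] at hT
  have hc : (S.card : ℝ) = T.card + (S \ T).card := by
    rw [← Finset.card_sdiff_add_card_eq_card hT.1]; push_cast; ring
  have hf : (T.card.factorial : ℝ) = T.card * (T.card - 1).factorial := by
    have := Nat.mul_factorial_pred (Finset.card_pos.2 ⟨a, hT.2⟩).ne'
    exact_mod_cast this.symm
  rw [hc, hf]
  ring

/-- The prediction rule of the Dirichlet process (Blackwell–MacQueen urn). -/
theorem urnMoment_insert [DecidableEq ι] (hθ : 0 < θ) (hA : ∀ i, MeasurableSet (A i))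
    (S : Finset ι) {a : ι} (ha : a ∉ S) :
    urnMoment θ ν A (insert a S) = θ * ν.real (A a) * urnMoment θ ν A S +
      ∑ i ∈ S, urnMoment θ ν (Function.update A i (A i ∩ A a)) S := by
  -- Here `T` is the block of `a` with `a` removed; `T = ∅` is the case where `a` has a value of its
  -- own.
  have h1 : urnMoment θ ν A (insert a S) = ∑ T ∈ S.powerset,
      θ * T.card.factorial * ν.real (A a ∩ ⋂ i ∈ T, A i) * urnMoment θ ν A (S \ T) := by
    rw [urnMoment_eq_sum hθ hA _ (Finset.mem_insert_self a S)]
    refine Finset.sum_bij' (fun T _ => T.erase a) (fun T _ => insert a T) ?_ ?_ ?_ ?_ ?_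
    · intro T hT
      simp only [Finset.mem_filter, Finset.mem_powerset] at hT ⊢
      rw [← Finset.erase_insert ha]; exact Finset.erase_subset_erase a hT.1
    · intro T hT
      simp only [Finset.mem_filter, Finset.mem_powerset] at hT ⊢
      exact ⟨Finset.insert_subset_insert a hT, Finset.mem_insert_self _ _⟩
    · intro T hT
      exact Finset.insert_erase (Finset.mem_filter.1 hT).2
    · intro T hT
      exact Finset.erase_insert fun h => ha (Finset.mem_powerset.1 hT h)
    · intro T hT
      obtain ⟨T', hT', rfl⟩ : ∃ T', a ∉ T' ∧ T = insert a T' :=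
        ⟨T.erase a, Finset.notMem_erase _ _, (Finset.insert_erase (Finset.mem_filter.1 hT).2).symm⟩
      rw [Finset.erase_insert hT', Finset.card_insert_of_notMem hT', Nat.add_sub_cancel,
        Finset.set_biInter_insert, Finset.insert_sdiff_insert, Finset.sdiff_insert_of_notMem ha]
  have h2 : ∀ i ∈ S, urnMoment θ ν (Function.update A i (A i ∩ A a)) S =
      ∑ T ∈ S.powerset with i ∈ T,
        θ * (T.card - 1).factorial * ν.real (A a ∩ ⋂ i ∈ T, A i) * urnMoment θ ν A (S \ T) := by
    intro i hi
    have hA' : ∀ j, MeasurableSet (Function.update A i (A i ∩ A a) j) := by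
      intro j
      by_cases h : j = i
      · subst h; simpa using (hA j).inter (hA a)
      · simpa [h] using hA j
    rw [urnMoment_eq_sum hθ hA' S hi]
    refine Finset.sum_congr rfl fun T hT => ?_
    have hiT := (Finset.mem_filter.1 hT).2
    congr 1
    · congr 2
      ext y
      simp only [Set.mem_iInter, Set.mem_inter_iff]
      constructor
      · intro h
        refine ⟨by simpa using (show _ ∧ _ by simpa using h i hiT).2, fun j hj => ?_⟩
        have := h j hj
        by_cases hji : j = i
        · subst hji; exact (show _ ∧ _ by simpa using this).1
        · simpa [hji] using this
      · rintro ⟨h0, h⟩ j hj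
        by_cases hji : j = i
        · subst hji; simpa using ⟨h j hj, h0⟩
        · simpa [hji] using h j hj
    · refine urnMoment_congr fun j hj => ?_
      have : j ≠ i := fun h => (Finset.mem_sdiff.1 hj).2 (h ▸ hiT)
      simp [this]
  rw [h1, Finset.sum_congr rfl h2, ← Finset.add_sum_erase _ _ (Finset.empty_mem_powerset S)]
  congr 1
  · simp
  -- A nonempty `T` is reached once from each `i ∈ T`, which turns `(|T|-1)!` into `|T|!`.
  · rw [Finset.sum_comm' (t' := S.powerset.erase ∅) (s' := fun T => T)]
    · refine Finset.sum_congr rfl fun T hT => ?_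
      rw [Finset.sum_const, nsmul_eq_mul, ← Nat.mul_factorial_pred
        (Finset.card_pos.2 (Finset.nonempty_iff_ne_empty.2 (Finset.mem_erase.1 hT).1)).ne']
      push_cast
      ring
    · intro i T
      simp only [Finset.mem_filter, Finset.mem_erase, Finset.mem_powerset]
      constructor
      · rintro ⟨_, h1, h2⟩
        exact ⟨h2, Finset.ne_empty_of_mem h2, h1⟩
      · rintro ⟨h1, _, h2⟩
        exact ⟨h2 h1, h2, h1⟩

end Moments

/-! ### The Pólya urn and its identification with the Dirichlet sample -/

section PolyaUrn

variable {W : Type*} [MeasurableSpace W]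

theorem measurable_vecCons {α : Type*} [MeasurableSpace α] {n : ℕ} {f : α → W}
    {g : α → Fin n → W} (hf : Measurable f) (hg : Measurable g) :
    Measurable fun a => Matrix.vecCons (f a) (g a) := by
  refine measurable_pi_iff.2 fun i => ?_
  refine Fin.cases ?_ (fun i => ?_) i
  · simpa using hf
  · simpa [Function.comp_def] using (measurable_pi_apply i).comp hg

/-- The law of the first `n` draws from a Pólya urn (Hoppe urn) with base measure `ρ` and
concentration `θ`; the most recent draw has index `0`. -/
noncomputable def polyaUrn (θ : ℝ) (ρ : Measure W) : (n : ℕ) → Measure (Fin n → W)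
  | 0 => Measure.dirac Matrix.vecEmpty
  | n + 1 => ENNReal.ofReal (θ + n)⁻¹ •
      (ENNReal.ofReal θ • (ρ.prod (polyaUrn θ ρ n)).map (fun p => Matrix.vecCons p.1 p.2) +
        ∑ i, (polyaUrn θ ρ n).map fun x => Matrix.vecCons (x i) x)

variable {θ : ℝ} {ρ : Measure W} [IsProbabilityMeasure ρ]

theorem measurable_vecCons_self {n : ℕ} (i : Fin n) :
    Measurable fun x : Fin n → W => Matrix.vecCons (x i) x :=
  measurable_vecCons (measurable_pi_apply i) measurable_id

theorem measurable_vecCons_prod {n : ℕ} :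
    Measurable fun p : W × (Fin n → W) => Matrix.vecCons p.1 p.2 :=
  measurable_vecCons measurable_fst measurable_snd

theorem isProbabilityMeasure_polyaUrn (hθ : 0 < θ) (n : ℕ) :
    IsProbabilityMeasure (polyaUrn θ ρ n) := by
  induction n with
  | zero => exact Measure.dirac.isProbabilityMeasure
  | succ n ih =>
    refine ⟨?_⟩
    have h1 := Measure.isProbabilityMeasure_map (μ := ρ.prod (polyaUrn θ ρ n))
      measurable_vecCons_prod.aemeasurable
    have h2 := fun i => Measure.isProbabilityMeasure_map (μ := polyaUrn θ ρ n)
      (measurable_vecCons_self i).aemeasurable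
    simp only [polyaUrn, Measure.smul_apply, Measure.add_apply, Measure.coe_finsetSum,
      Finset.sum_apply, measure_univ, smul_eq_mul, mul_one, Finset.sum_const, Finset.card_univ,
      Fintype.card_fin, nsmul_eq_mul]
    rw [← ENNReal.ofReal_natCast n, ← ENNReal.ofReal_add hθ.le (by positivity),
      ← ENNReal.ofReal_mul (by positivity), inv_mul_cancel₀ (by positivity), ENNReal.ofReal_one]

theorem lintegral_polyaUrn_succ (hθ : 0 < θ) (n : ℕ) {F : (Fin (n + 1) → W) → ℝ≥0∞}
    (hF : Measurable F) :
    ∫⁻ x, F x ∂polyaUrn θ ρ (n + 1) = ENNReal.ofReal (θ + n)⁻¹ *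
      (ENNReal.ofReal θ * ∫⁻ x, ∫⁻ y, F (Matrix.vecCons y x) ∂ρ ∂polyaUrn θ ρ n +
        ∑ i, ∫⁻ x, F (Matrix.vecCons (x i) x) ∂polyaUrn θ ρ n) := by
  have := isProbabilityMeasure_polyaUrn (ρ := ρ) hθ n
  rw [polyaUrn, lintegral_smul_measure, lintegral_add_measure, lintegral_smul_measure,
    lintegral_finsetSum_measure, lintegral_map hF measurable_vecCons_prod,
    lintegral_prod_symm (fun p : W × (Fin n → W) => F (Matrix.vecCons p.1 p.2))
      (hF.comp measurable_vecCons_prod).aemeasurable]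
  simp_rw [lintegral_map hF (measurable_vecCons_self _), smul_eq_mul]

theorem urnMoment_map {V ι κ : Type*} [MeasurableSpace V] (θ : ℝ) (ν : Measure V)
    (A : κ → Set V) (e : ι ↪ κ) (S : Finset ι) :
    urnMoment θ ν A (S.map e) = urnMoment θ ν (A ∘ e) S := by
  simp [urnMoment, dpMoment]

/-- Both sides obey the same recursion: if the newest draw copies draw `i`, the box condition
becomes the box with `A i` cut down to its intersection with `A 0`, exactly as in
`urnMoment_insert`. -/
theorem polyaUrn_pi (hθ : 0 < θ) {n : ℕ} {A : Fin n → Set W} (hA : ∀ i, MeasurableSet (A i)) :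
    (polyaUrn θ ρ n).real (Set.univ.pi A) = urnMoment θ ρ A Finset.univ / rising θ n := by
  induction n with
  | zero =>
    have : Set.univ.pi A = Set.univ := by ext; simp
    have h := isProbabilityMeasure_polyaUrn (ρ := ρ) hθ 0
    rw [this, Finset.univ_eq_empty, urnMoment_empty hθ, rising_zero]
    simp
  | succ n ih =>
    have := isProbabilityMeasure_polyaUrn (ρ := ρ) hθ n
    set B : Fin n → Set W := fun i => A i.succ with hB
    have hBm : ∀ i, MeasurableSet (B i) := fun i => hA _
    have hBm' : ∀ i j, MeasurableSet (Function.update B i (B i ∩ A 0) j) := by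
      intro i j
      by_cases h : j = i
      · subst h; simpa using (hBm j).inter (hA 0)
      · simpa [h] using hBm j
    have hAm : MeasurableSet (Set.univ.pi A) := MeasurableSet.univ_pi hA
    have e1 : (fun p : W × (Fin n → W) => Matrix.vecCons p.1 p.2) ⁻¹' Set.univ.pi A =
        A 0 ×ˢ Set.univ.pi B := by
      ext p
      simp [Fin.forall_fin_succ, hB]
    have e2 : ∀ i, (fun x : Fin n → W => Matrix.vecCons (x i) x) ⁻¹' Set.univ.pi A =
        Set.univ.pi (Function.update B i (B i ∩ A 0)) := by
      intro i
      ext x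
      simp only [Set.mem_preimage, Set.mem_univ_pi, Fin.forall_fin_succ, Matrix.cons_val_zero,
        Matrix.cons_val_succ]
      constructor
      · rintro ⟨h0, h⟩ j
        by_cases hj : j = i
        · subst hj; simpa using ⟨h j, h0⟩
        · simpa [hj] using h j
      · intro h
        have hi : x i ∈ B i ∩ A 0 := by simpa using h i
        refine ⟨hi.2, fun j => ?_⟩
        by_cases hj : j = i
        · subst hj; exact hi.1
        · simpa [hj] using h j
    have hS : (Finset.univ : Finset (Fin (n + 1))) =
        insert 0 (Finset.univ.map (Fin.succEmb n)) := by
      ext i; refine Fin.cases ?_ (fun i => ?_) i <;> simp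
    have hupd : ∀ i : Fin n, Function.update A i.succ (A i.succ ∩ A 0) ∘ Fin.succEmb n =
        Function.update B i (B i ∩ A 0) := by
      intro i
      ext1 j
      by_cases hj : j = i
      · subst hj; simp [hB]
      · simp [hj, hB]
    have hrhs : urnMoment θ ρ A Finset.univ = θ * ρ.real (A 0) * urnMoment θ ρ B Finset.univ +
        ∑ i, urnMoment θ ρ (Function.update B i (B i ∩ A 0)) Finset.univ := by
      rw [hS, urnMoment_insert hθ hA _ (by simp), urnMoment_map, Finset.sum_map]
      congr 1
      refine Finset.sum_congr rfl fun i _ => ?_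
      rw [urnMoment_map, show Fin.succEmb n i = i.succ from rfl, hupd]
    have hr := (rising_pos hθ n).ne'
    have hn : θ + n ≠ 0 := by positivity
    simp only [Measure.real, polyaUrn, Measure.smul_apply, Measure.add_apply,
      Measure.coe_finsetSum, Finset.sum_apply, smul_eq_mul,
      Measure.map_apply measurable_vecCons_prod hAm,
      Measure.map_apply (measurable_vecCons_self _) hAm, e1, e2, Measure.prod_prod]
    rw [ENNReal.toReal_mul, ENNReal.toReal_add (by finiteness)
      (ENNReal.sum_ne_top.2 fun i _ => measure_ne_top _ _), ENNReal.toReal_mul, ENNReal.toReal_mul, ENNReal.toReal_sum fun i _ => by finiteness,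
      ENNReal.toReal_ofReal hθ.le, ENNReal.toReal_ofReal (by positivity)]
    change (θ + n)⁻¹ * (θ * (ρ.real (A 0) * (polyaUrn θ ρ n).real (Set.univ.pi B)) +
      ∑ i, (polyaUrn θ ρ n).real _) = _
    rw [ih hBm, Finset.sum_congr rfl fun i _ => ih (hBm' i), hrhs, rising_succ, ← Finset.sum_div]
    field_simp

/-- A sample from a Dirichlet process is a Pólya urn sequence. -/
theorem IsSampleFrom.map_eq_polyaUrn {Ω : Type*} [MeasurableSpace Ω] {μ : Measure Ω}
    [IsProbabilityMeasure μ] (hθ : 0 < θ) {n : ℕ} {P : Ω → Measure W}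
    (hP : μ.map P = dirichletProcess θ ρ) {X : Fin n → Ω → W} (hX : IsSampleFrom μ P X) :
    μ.map (fun ω i => X i ω) = polyaUrn θ ρ n := by
  have hXm : Measurable fun ω i => X i ω := measurable_pi_iff.2 hX.measurable
  have h1 := isProbabilityMeasure_polyaUrn (ρ := ρ) hθ n
  have h2 : IsProbabilityMeasure (μ.map fun ω i => X i ω) :=
    Measure.isProbabilityMeasure_map hXm.aemeasurable
  refine ext_of_generate_finite _ generateFrom_pi.symm isPiSystem_pi ?_ (by simp)
  rintro _ ⟨A, hA, rfl⟩
  have hA' : ∀ i, MeasurableSet (A i) := fun i => hA i (Set.mem_univ i)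
  have hlaw := hX.law Set.univ A MeasurableSet.univ hA'
  have hmom : ∫⁻ ω, ∏ i, P ω (A i) ∂μ = dpMoment θ ρ A Finset.univ := by
    rw [dpMoment, ← hP, lintegral_map (measurable_prod_apply hA' _) hX.measurable_prior]
  rw [← measureReal_eq_measureReal_iff, polyaUrn_pi hθ hA', urnMoment, Finset.card_univ,
    Fintype.card_fin, mul_div_cancel_left₀ _ (rising_pos hθ n).ne', Measure.real,
    Measure.map_apply hXm (MeasurableSet.univ_pi hA'), ← hmom]
  congr 1
  simpa [Set.preimage, Set.mem_pi] using hlaw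

end PolyaUrn

/-! ### Attaching independent uniform buckets to the values -/

section Hashing

variable {Ω V : Type*} [MeasurableSpace Ω] {J : ℕ}

/-- The probability that the points `x_i` are hashed into the buckets `b_i`. -/
noncomputable def hashProb (μ : Measure Ω) (h : Ω → V → Fin J) {n : ℕ} (x : Fin n → V)
    (b : Fin n → Fin J) : ℝ≥0∞ :=
  μ {ω | ∀ i, h ω (x i) = b i}

/-- A repeated value imposes no new condition if the prescribed buckets agree, and a contradiction
otherwise. -/
theorem hashProb_cons_self {μ : Measure Ω} {h : Ω → V → Fin J} {n : ℕ} (x : Fin n → V)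
    (b : Fin n → Fin J) (i : Fin n) (c : Fin J) :
    hashProb μ h (Matrix.vecCons (x i) x) (Matrix.vecCons c b) =
      if c = b i then hashProb μ h x b else 0 := by
  unfold hashProb
  split_ifs with hc
  · congr 1
    ext ω
    simp only [Set.mem_ofPred_eq, Fin.forall_fin_succ, Matrix.cons_val_zero, Matrix.cons_val_succ,
      and_iff_right_iff_imp, hc]
    exact fun H => H i
  · convert! measure_empty (μ := μ)
    ext ω
    simp only [Set.mem_ofPred_eq, Fin.forall_fin_succ, Matrix.cons_val_zero, Matrix.cons_val_succ,
      Set.mem_empty_iff_false, iff_false, not_and]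
    exact fun h0 H => hc (h0.symm.trans (H i))

theorem hashProb_cons_of_notMem {μ : Measure Ω} {h : Ω → V → Fin J}
    (hh : IsPerfectlyRandomHash μ h) {n : ℕ} (x : Fin n → V) (b : Fin n → Fin J) {y : V}
    (hy : ∀ i, y ≠ x i) (c : Fin J) :
    hashProb μ h (Matrix.vecCons y x) (Matrix.vecCons c b) =
      (J : ℝ≥0∞)⁻¹ * hashProb μ h x b := by
  classical
  -- The buckets permitted at `v` by all indices carrying the value `v`. Grouping the conditions by
  -- value is needed since independence holds over distinct points, while the `x i` may coincide.
  set B : V → Set (Fin J) := fun v => {d | ∀ i, Matrix.vecCons y x i = v →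
    d = Matrix.vecCons c b i} with hB
  have hyS : y ∉ Finset.univ.image x := by
    simpa [eq_comm] using hy
  have e1 : {ω | ∀ i, h ω (Matrix.vecCons y x i) = Matrix.vecCons c b i} =
      ⋂ v ∈ insert y (Finset.univ.image x), (fun ω => h ω v) ⁻¹' B v := by
    ext ω
    simp only [Set.mem_ofPred_eq, Set.mem_iInter, Set.mem_preimage, hB]
    constructor
    · rintro H v _ i rfl
      exact H i
    · intro H i
      refine H _ ?_ i rfl
      refine Fin.cases ?_ (fun i => ?_) i <;> simp
  have e2 : {ω | ∀ i, h ω (x i) = b i} =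
      ⋂ v ∈ Finset.univ.image x, (fun ω => h ω v) ⁻¹' B v := by
    ext ω
    simp only [Set.mem_ofPred_eq, Set.mem_iInter, Set.mem_preimage, hB]
    constructor
    · rintro H v hv i
      refine Fin.cases ?_ (fun i => ?_) i
      · rintro h0
        exact absurd ((show y = v from h0) ▸ hv) hyS
      · rintro rfl
        simpa using H i
    · intro H i
      simpa using H (x i) (by simp) i.succ (by simp)
  have e3 : (fun ω => h ω y) ⁻¹' B y = {ω | h ω y = c} := by
    ext ω
    simp only [Set.mem_preimage, hB, Set.mem_ofPred_eq, Fin.forall_fin_succ, Matrix.cons_val_zero,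
      Matrix.cons_val_succ, forall_const, and_iff_left_iff_imp]
    exact fun _ i hi => absurd hi.symm (hy i)
  rw [hashProb, hashProb, e1, e2,
    hh.indep.measure_inter_preimage_eq_mul _ fun _ _ => MeasurableSet.of_discrete,
    hh.indep.measure_inter_preimage_eq_mul _ fun _ _ => MeasurableSet.of_discrete,
    Finset.prod_insert hyS, e3, hh.uniform]

/-- For fixed `b`, the probability depends on `x` only through which coordinates coincide, and
measurability of the diagonal makes these coincidences measurable. -/
theorem measurable_hashProb [MeasurableSpace V] [MeasurableEq V] {μ : Measure Ω}
    {h : Ω → V → Fin J} (hh : IsPerfectlyRandomHash μ h) {n : ℕ} (b : Fin n → Fin J) :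
    Measurable fun x : Fin n → V => hashProb μ h x b := by
  classical
  induction n with
  | zero => exact measurable_of_finite _
  | succ n ih =>
    have hrec : (fun x : Fin (n + 1) → V => hashProb μ h x b) = fun x =>
        if ∀ i : Fin n, x 0 ≠ x i.succ then
          (J : ℝ≥0∞)⁻¹ * hashProb μ h (fun i => x i.succ) (fun i => b i.succ)
        else if ∃ i : Fin n, x 0 = x i.succ ∧ b 0 = b i.succ then
          hashProb μ h (fun i => x i.succ) (fun i => b i.succ) else
          0 := by
      ext x
      have hx : Matrix.vecCons (x 0) (fun i => x i.succ) = x := by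
        ext i; refine Fin.cases ?_ (fun i => ?_) i <;> simp
      have hb : Matrix.vecCons (b 0) (fun i => b i.succ) = b := by
        ext i; refine Fin.cases ?_ (fun i => ?_) i <;> simp
      split_ifs with h1 h2
      · conv_lhs => rw [← hx, ← hb]
        exact hashProb_cons_of_notMem hh _ _ h1 _
      · obtain ⟨i, hi, hbi⟩ := h2
        conv_lhs => rw [← hx, ← hb, hi]
        rw [hashProb_cons_self (fun i => x i.succ), if_pos hbi]
      · push Not at h1
        obtain ⟨i, hi⟩ := h1
        conv_lhs => rw [← hx, ← hb, hi]
        rw [hashProb_cons_self (fun i => x i.succ), if_neg fun hbi => h2 ⟨i, hi, hbi⟩]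
    have hm : Measurable fun x : Fin (n + 1) → V =>
        hashProb μ h (fun i => x i.succ) (fun i => b i.succ) :=
      (ih fun i => b i.succ).comp (by fun_prop)
    have he : ∀ i : Fin n, MeasurableSet {x : Fin (n + 1) → V | x 0 = x i.succ} := fun i =>
      measurableSet_eq_fun (measurable_pi_apply 0) (measurable_pi_apply _)
    rw [hrec]
    refine Measurable.ite ?_ (hm.const_mul _) (Measurable.ite ?_ hm measurable_const)
    · simp only [ne_eq, Set.ofPred_forall]
      exact MeasurableSet.iInter fun i => (he i).compl
    · simp only [Set.ofPred_exists]
      exact MeasurableSet.iUnion fun i => (he i).inter (MeasurableSet.const _)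

/-- The uniform distribution on the `J` buckets. -/
noncomputable def uniformBucket (J : ℕ) : Measure (Fin J) := (J : ℝ≥0∞)⁻¹ • Measure.count

theorem isProbabilityMeasure_uniformBucket (hJ : 1 ≤ J) :
    IsProbabilityMeasure (uniformBucket J) := by
  refine ⟨?_⟩
  rw [uniformBucket, Measure.smul_apply, Measure.count_univ, smul_eq_mul]
  simp only [ENat.card_eq_coe_fintype_card, Fintype.card_fin]
  exact ENNReal.inv_mul_cancel (by exact_mod_cast (by omega : J ≠ 0)) (by simp)

theorem lintegral_prod_uniformBucket [MeasurableSpace V] (hJ : 1 ≤ J) (ν : Measure V)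
    [SFinite ν] {F : V × Fin J → ℝ≥0∞} (hF : Measurable F) :
    ∫⁻ z, F z ∂ν.prod (uniformBucket J) = ∑ c, (J : ℝ≥0∞)⁻¹ * ∫⁻ y, F (y, c) ∂ν := by
  have := isProbabilityMeasure_uniformBucket hJ
  rw [lintegral_prod_symm _ hF.aemeasurable, uniformBucket, lintegral_smul_measure,
    lintegral_count, tsum_fintype, smul_eq_mul, Finset.mul_sum]

theorem vecCons_pair {n : ℕ} (y : V) (c : Fin J) (x : Fin n → V) (b : Fin n → Fin J) :
    (fun i => (Matrix.vecCons y x i, Matrix.vecCons c b i)) =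
      Matrix.vecCons (y, c) fun i => (x i, b i) := by
  ext1 i; refine Fin.cases ?_ (fun i => ?_) i <;> simp

theorem sum_fin_succ_fun {α M : Type*} [Fintype α] [AddCommMonoid M] {n : ℕ}
    (f : (Fin (n + 1) → α) → M) : ∑ b, f b = ∑ b, ∑ c, f (Matrix.vecCons c b) := by
  rw [← (Fin.consEquiv fun _ => α).sum_comp, Fintype.sum_prod_type_right]
  rfl

theorem measurable_pair [MeasurableSpace V] {n : ℕ} (b : Fin n → Fin J) :
    Measurable fun (x : Fin n → V) i => (x i, b i) := by fun_prop

/-- Hashing the values of an urn on `V` gives the same law as running the urn on `V × Fin J`. In the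
induction, a fresh draw gains the factor `1/J` on either side, and a copied draw also copies its
bucket. -/
theorem lintegral_polyaUrn_prod [MeasurableSpace V] [MeasurableEq V] {μ : Measure Ω}
    [IsProbabilityMeasure μ] {h : Ω → V → Fin J} (hh : IsPerfectlyRandomHash μ h) (hJ : 1 ≤ J)
    {ν : Measure V} [IsProbabilityMeasure ν] [NullSingletonClass ν] {θ : ℝ} (hθ : 0 < θ) {n : ℕ}
    {F : (Fin n → V × Fin J) → ℝ≥0∞} (hF : Measurable F) :
    ∫⁻ z, F z ∂polyaUrn θ (ν.prod (uniformBucket J)) n =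
      ∑ b, ∫⁻ x, hashProb μ h x b * F (fun i => (x i, b i)) ∂polyaUrn θ ν n := by
  have := isProbabilityMeasure_uniformBucket hJ
  induction n with
  | zero =>
    have hm : Measurable fun x : Fin 0 → V =>
        hashProb μ h x Matrix.vecEmpty * F (fun i => (x i, Matrix.vecEmpty i)) :=
      measurable_of_finite _
    rw [Fintype.sum_unique]
    rw [show (default : Fin 0 → Fin J) = Matrix.vecEmpty from Subsingleton.elim _ _, polyaUrn,
      polyaUrn, lintegral_dirac' _ hF, lintegral_dirac' _ hm]
    simp only [hashProb, IsEmpty.forall_iff, Set.ofPred_true, measure_univ, one_mul]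
    congr 1
    exact Subsingleton.elim _ _
  | succ n ih =>
    have hpv := isProbabilityMeasure_polyaUrn (ρ := ν) hθ n
    have hpz := isProbabilityMeasure_polyaUrn (ρ := ν.prod (uniformBucket J)) hθ n
    have hκ : ∀ {n : ℕ} (b : Fin n → Fin J), Measurable fun x : Fin n → V => hashProb μ h x b :=
      fun b => measurable_hashProb hh b
    have hFnew : Measurable fun z : Fin n → V × Fin J =>
        ∫⁻ w, F (Matrix.vecCons w z) ∂ν.prod (uniformBucket J) :=
      (hF.comp (measurable_vecCons measurable_snd measurable_fst)).lintegral_prod_right'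
    have hFold : ∀ i, Measurable fun z : Fin n → V × Fin J => F (Matrix.vecCons (z i) z) :=
      fun i => hF.comp (measurable_vecCons_self i)
    have hFb : ∀ b, Measurable fun x : Fin (n + 1) → V =>
        hashProb μ h x b * F (fun i => (x i, b i)) :=
      fun b => (hκ b).mul (hF.comp (measurable_pair b))
    have hFc : ∀ (b : Fin n → Fin J) (c : Fin J), Measurable fun p : (Fin n → V) × V =>
        F (Matrix.vecCons (p.2, c) fun i => (p.1 i, b i)) := fun b c =>
      hF.comp (measurable_vecCons (by fun_prop) (by fun_prop))
    have hnew : ∀ b : Fin n → Fin J, ∫⁻ x, hashProb μ h x b *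
          ∫⁻ w, F (Matrix.vecCons w fun i => (x i, b i)) ∂ν.prod (uniformBucket J)
            ∂polyaUrn θ ν n =
        ∑ c, ∫⁻ x, ∫⁻ y, hashProb μ h (Matrix.vecCons y x) (Matrix.vecCons c b) *
          F (fun i => (Matrix.vecCons y x i, Matrix.vecCons c b i)) ∂ν ∂polyaUrn θ ν n := by
      intro b
      have hpt : ∀ (x : Fin n → V) (c : Fin J),
          ∫⁻ y, hashProb μ h (Matrix.vecCons y x) (Matrix.vecCons c b) *
            F (fun i => (Matrix.vecCons y x i, Matrix.vecCons c b i)) ∂ν =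
          hashProb μ h x b * ((J : ℝ≥0∞)⁻¹ *
            ∫⁻ y, F (Matrix.vecCons (y, c) fun i => (x i, b i)) ∂ν) := by
        intro x c
        -- Non-atomicity: a fresh draw almost surely avoids the finitely many earlier values.
        have hae : ∀ᵐ y ∂ν, ∀ i, y ≠ x i := by
          rw [ae_all_iff]
          intro i
          exact (measure_eq_zero_iff_ae_notMem.1 (measure_singleton (μ := ν) (x i))).mono
            fun y hy => hy
        have hm : Measurable fun y => F (Matrix.vecCons (y, c) fun i => (x i, b i)) :=
          (hFc b c).comp measurable_prodMk_left
        rw [← lintegral_const_mul _ hm, ← lintegral_const_mul _ (hm.const_mul _)]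
        refine lintegral_congr_ae ?_
        filter_upwards [hae] with y hy
        rw [hashProb_cons_of_notMem hh x b hy, vecCons_pair]
        ring
      simp_rw [hpt]
      have hm : ∀ c, Measurable fun x => hashProb μ h x b * ((J : ℝ≥0∞)⁻¹ *
          ∫⁻ y, F (Matrix.vecCons (y, c) fun i => (x i, b i)) ∂ν) := fun c =>
        (hκ b).mul (((hFc b c).lintegral_prod_right').const_mul _)
      rw [← lintegral_finsetSum _ fun c _ => hm c]
      refine lintegral_congr fun x => ?_
      rw [lintegral_prod_uniformBucket hJ ν (F := fun w => F (Matrix.vecCons w fun i => (x i, b i)))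
        (hF.comp (measurable_vecCons measurable_id measurable_const)), Finset.mul_sum]
    have hold : ∀ (i : Fin n) (b : Fin n → Fin J), ∫⁻ x, hashProb μ h x b *
          F (Matrix.vecCons (x i, b i) fun i => (x i, b i)) ∂polyaUrn θ ν n =
        ∑ c, ∫⁻ x, hashProb μ h (Matrix.vecCons (x i) x) (Matrix.vecCons c b) *
          F (fun j => (Matrix.vecCons (x i) x j, Matrix.vecCons c b j)) ∂polyaUrn θ ν n := by
      intro i b
      -- A copy of draw `i` can only be hashed to the bucket `b i`.
      rw [Finset.sum_eq_single (b i)]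
      · simp_rw [hashProb_cons_self, if_true, vecCons_pair]
      · intro c _ hc
        simp [hashProb_cons_self, hc]
      · simp
    rw [lintegral_polyaUrn_succ hθ n hF, ih hFnew, Finset.sum_congr rfl fun i _ => ih (hFold i)]
    simp_rw [lintegral_polyaUrn_succ hθ n (hFb _)]
    rw [← Finset.mul_sum, Finset.sum_add_distrib, ← Finset.mul_sum, sum_fin_succ_fun,
      Finset.sum_congr rfl fun b _ => hnew b, Finset.sum_comm (s := Finset.univ (α := Fin n))]
    congr 2
    rw [sum_fin_succ_fun]
    refine Finset.sum_congr rfl fun b _ => ?_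
    rw [Finset.sum_congr rfl fun i _ => hold i b, Finset.sum_comm]

/-- The sample from a Dirichlet process together with the hashed values is a Pólya urn sequence. -/
theorem IsDrawnIndependently.map_eq_polyaUrn [MeasurableSpace V] [MeasurableEq V] {μ : Measure Ω}
    [IsProbabilityMeasure μ] {h : Ω → V → Fin J} (hh : IsPerfectlyRandomHash μ h) (hJ : 1 ≤ J)
    {ν : Measure V} [IsProbabilityMeasure ν] [NullSingletonClass ν] {θ : ℝ} (hθ : 0 < θ) {n : ℕ}
    {P : Ω → Measure V} (hP : μ.map P = dirichletProcess θ ν) {X : Fin n → Ω → V}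
    (hX : IsSampleFrom μ P X) (hhX : IsDrawnIndependently μ h X) :
    μ.map (fun ω i => (X i ω, h ω (X i ω))) = polyaUrn θ (ν.prod (uniformBucket J)) n := by
  have hXm : Measurable fun ω i => X i ω := measurable_pi_iff.2 hX.measurable
  have hHm : Measurable fun ω i => h ω (X i ω) := measurable_pi_iff.2 hhX.measurable
  have hZm : Measurable fun ω i => (X i ω, h ω (X i ω)) :=
    measurable_pi_iff.2 fun i => (hX.measurable i).prodMk (hhX.measurable i)
  ext S hS
  rw [Measure.map_apply hZm hS, ← lintegral_indicator_one hS,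
    lintegral_polyaUrn_prod hh hJ hθ (measurable_one.indicator hS)]
  have hSb : ∀ b : Fin n → Fin J, MeasurableSet {x : Fin n → V | (fun i => (x i, b i)) ∈ S} :=
    fun b => measurable_pair b hS
  set S' := (fun ω i => (X i ω, h ω (X i ω))) ⁻¹' S with hS'
  -- Partition by the vector of hashed values, so that the law in `IsDrawnIndependently` applies to
  -- each piece.
  have h1 : μ S' = ∑ b : Fin n → Fin J, μ {ω | (fun i => X i ω) ∈
      {x : Fin n → V | (fun i => (x i, b i)) ∈ S} ∧ ∀ i, h ω (X i ω) = b i} := by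
    have := sum_measure_preimage_singleton (μ := μ.restrict S') (Finset.univ)
      (f := fun ω i => h ω (X i ω)) fun b _ => hHm (measurableSet_singleton b)
    rw [Finset.coe_univ, Set.preimage_univ, Measure.restrict_apply_univ] at this
    rw [← this]
    refine Finset.sum_congr rfl fun b _ => ?_
    rw [Measure.restrict_apply (hHm (measurableSet_singleton b))]
    congr 1
    ext ω
    simp only [hS', Set.mem_inter_iff, Set.mem_preimage, Set.mem_singleton_iff, Set.mem_ofPred_eq]
    constructor
    · rintro ⟨rfl, h2⟩
      exact ⟨h2, fun _ => rfl⟩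
    · rintro ⟨h2, h3⟩
      have : (fun i => h ω (X i ω)) = b := funext h3
      subst this
      exact ⟨rfl, h2⟩
  rw [h1]
  refine Finset.sum_congr rfl fun b _ => ?_
  have hXb : MeasurableSet {ω | (fun i => X i ω) ∈ {x : Fin n → V | (fun i => (x i, b i)) ∈ S}} :=
    hXm (hSb b)
  have hm : Measurable fun x : Fin n → V =>
      hashProb μ h x b * S.indicator (1 : (Fin n → V × Fin J) → ℝ≥0∞) fun i => (x i, b i) :=
    (measurable_hashProb hh b).mul ((measurable_one.indicator hS).comp (measurable_pair b))
  rw [hhX.law _ b (hSb b), ← IsSampleFrom.map_eq_polyaUrn hθ hP hX, lintegral_map hm hXm,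
    ← lintegral_indicator hXb]
  refine lintegral_congr fun ω => ?_
  by_cases hω : (fun i => (X i ω, b i)) ∈ S
  · simp [hω, hashProb]
  · simp [hω]

end Hashing

/-! ### Type counts in the urn: the Dirichlet-multinomial law -/

/-- With the convention for negative `k` the recurrence holds on all of `ℤ`, so the induction on
counts has no boundary cases. -/
theorem mul_risingOverFactorial (a : ℝ) (k : ℤ) :
    (k : ℝ) * risingOverFactorial a k = (a + k - 1) * risingOverFactorial a (k - 1) := by
  rcases lt_trichotomy k 0 with hk | rfl | hk
  · simp [risingOverFactorial, hk.not_ge, show ¬ (1 ≤ k) by omega]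
  · simp [risingOverFactorial]
  · obtain ⟨n, rfl⟩ : ∃ n : ℕ, k = n + 1 := ⟨(k - 1).toNat, by omega⟩
    have h1 : ((n : ℤ) + 1).toNat = n + 1 := by omega
    simp only [risingOverFactorial, show (0 : ℤ) ≤ n + 1 by omega, if_true, h1, add_sub_cancel_right,
      Int.natCast_nonneg, Int.toNat_natCast, Nat.factorial_succ, rising_succ]
    have := (Nat.cast_pos (α := ℝ).2 n.factorial_pos).ne'
    push_cast
    field_simp
    ring

section UrnCounts

variable {W T : Type*} {m : ℕ}

/-- The first two draws of a Pólya urn sequence of length `m + 2`. -/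
def firstTwo (z : Fin (m + 2) → W) : W × W := (z (Fin.natAdd m 0), z (Fin.natAdd m 1))

/-- The number of draws of type `t` among the last `m` draws of a Pólya urn sequence, where the
classification `τ` may depend on the first two draws. -/
def typeCount [DecidableEq T] (τ : W × W → W → T) (z : Fin (m + 2) → W) (t : T) : ℕ :=
  (Finset.univ.filter fun i : Fin m => τ (firstTwo z) (z (Fin.castAdd 2 i)) = t).card

/-- Prepending a draw shifts the older ones by one index, as does replacing `m` by `m + 1` in
`Fin.natAdd`. -/
theorem firstTwo_vecCons (y : W) (z : Fin (m + 2) → W) :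
    firstTwo (m := m + 1) (Matrix.vecCons y z) = firstTwo z := rfl

theorem typeCount_vecCons [DecidableEq T] (τ : W × W → W → T) (y : W) (z : Fin (m + 2) → W)
    (t : T) : typeCount (m := m + 1) τ (Matrix.vecCons y z) t =
      (if τ (firstTwo z) y = t then 1 else 0) + typeCount τ z t := by
  rw [typeCount, typeCount, Finset.card_filter, Finset.card_filter, Fin.sum_univ_succ]
  rfl

variable [MeasurableSpace W]

theorem measurable_firstTwo : Measurable (firstTwo : (Fin (m + 2) → W) → W × W) := by
  unfold firstTwo; fun_prop

theorem measurableSet_typeCount_eq [DecidableEq T] {τ : W × W → W → T}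
    (hτ : ∀ t, MeasurableSet {p : (W × W) × W | τ p.1 p.2 = t}) (t : T) (k : ℤ) :
    MeasurableSet {z : Fin (m + 2) → W | (typeCount τ z t : ℤ) = k} := by
  have h : Measurable fun z : Fin (m + 2) → W => (typeCount τ z t : ℤ) := by
    simp only [typeCount, Finset.card_filter, Nat.cast_sum]
    refine Finset.measurable_fun_sum _ fun i _ => ?_
    have := measurable_from_top (f := fun n : ℕ => (n : ℤ))
    refine this.comp (Measurable.ite ?_ measurable_const measurable_const)
    exact (measurable_firstTwo.prodMk (measurable_pi_apply _)) (hτ t)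
  exact h (measurableSet_singleton k)

variable {θ : ℝ} {ρ : Measure W} [IsProbabilityMeasure ρ] [Fintype T] [DecidableEq T]
  {τ : W × W → W → T} {σ : Set (W × W)} {w : T → ℝ}

theorem measurableSet_firstTwo_mem_typeCount_eq
    (hτ : ∀ t, MeasurableSet {p : (W × W) × W | τ p.1 p.2 = t}) (hσ : MeasurableSet σ)
    (N : T → ℤ) : MeasurableSet
      {z : Fin (m + 2) → W | firstTwo z ∈ σ ∧ ∀ t, (typeCount τ z t : ℤ) = N t} := by
  simp only [Set.ofPred_and, Set.ofPred_forall]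
  exact (measurable_firstTwo hσ).inter
    (MeasurableSet.iInter fun t => measurableSet_typeCount_eq hτ t _)

/-- Condition on the type `t` of the newest draw. Before it, the count of `t` was `N t - 1`, and the
urn held mass `w t + N t - 1` of this type out of `θ + 2 + m`. By `hw`, the initial mass `w t` is
the same for all queries in `σ`. -/
theorem polyaUrn_typeCount_succ (hθ : 0 < θ)
    (hτ : ∀ t, MeasurableSet {p : (W × W) × W | τ p.1 p.2 = t}) (hσ : MeasurableSet σ)
    (hw : ∀ u ∈ σ, ∀ t, θ * ρ.real {y | τ u y = t} +
      ((if τ u u.1 = t then 1 else 0) + (if τ u u.2 = t then 1 else 0)) = w t)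
    (m : ℕ) (N : T → ℤ) :
    (θ + 2 + m) * (polyaUrn θ ρ (m + 1 + 2)).real
        {z | firstTwo z ∈ σ ∧ ∀ t, (typeCount τ z t : ℤ) = N t} =
      ∑ t, (w t + N t - 1) * (polyaUrn θ ρ (m + 2)).real
        {z | firstTwo z ∈ σ ∧ ∀ s, (typeCount τ z s : ℤ) = N s - if s = t then 1 else 0} := by
  have hprob := isProbabilityMeasure_polyaUrn (ρ := ρ) hθ (m + 2)
  set D : T → Set (Fin (m + 2) → W) := fun t =>
    {z | firstTwo z ∈ σ ∧ ∀ s, (typeCount τ z s : ℤ) = N s - if s = t then 1 else 0} with hD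
  have hDm : ∀ t, MeasurableSet (D t) := fun t =>
    measurableSet_firstTwo_mem_typeCount_eq hτ hσ _
  set S : Set (Fin (m + 1 + 2) → W) :=
    {z | firstTwo z ∈ σ ∧ ∀ t, (typeCount τ z t : ℤ) = N t} with hS
  have hSm : MeasurableSet S := measurableSet_firstTwo_mem_typeCount_eq hτ hσ _
  let E : T → Set ((W × W) × W) := fun t => {p | τ p.1 p.2 = t}
  have hcons : ∀ (y : W) (x : Fin (m + 2) → W), S.indicator (1 : (Fin (m + 1 + 2) → W) → ℝ≥0∞)
      (Matrix.vecCons y x) = ∑ t, (D t).indicator 1 x * (E t).indicator 1 (firstTwo x, y) := by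
    intro y x
    -- Only the actual type of the new draw `y` contributes.
    rw [Finset.sum_eq_single (τ (firstTwo x) y)]
    · have h1 : (firstTwo x, y) ∈ E (τ (firstTwo x) y) := rfl
      have h2 : Matrix.vecCons y x ∈ S ↔ x ∈ D (τ (firstTwo x) y) := by
        simp only [hS, hD, Set.mem_ofPred_eq, typeCount_vecCons, firstTwo_vecCons]
        refine and_congr_right fun _ => forall_congr' fun s => ?_
        simp only [eq_comm (a := τ (firstTwo x) y)]
        split_ifs <;> push_cast <;> omega
      rw [Set.indicator_of_mem h1, Pi.one_apply, mul_one]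
      by_cases h : x ∈ D (τ (firstTwo x) y)
      · rw [Set.indicator_of_mem h, Set.indicator_of_mem (h2.2 h)]; rfl
      · rw [Set.indicator_of_notMem h, Set.indicator_of_notMem (mt h2.1 h)]
    · intro t _ ht
      rw [Set.indicator_of_notMem (s := E t) (fun h => ht (Eq.symm h)), mul_zero]
    · simp
  have hEm : ∀ t, Measurable fun p : (Fin (m + 2) → W) × W =>
      (E t).indicator (1 : (W × W) × W → ℝ≥0∞) (firstTwo p.1, p.2) := fun t =>
    (measurable_one.indicator (hτ t)).comp
      ((measurable_firstTwo.comp measurable_fst).prodMk measurable_snd)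
  have hDi : ∀ t, Measurable ((D t).indicator (1 : (Fin (m + 2) → W) → ℝ≥0∞)) := fun t =>
    measurable_one.indicator (hDm t)
  have hEi : ∀ t i, Measurable fun x : Fin (m + 2) → W =>
      (E t).indicator (1 : (W × W) × W → ℝ≥0∞) (firstTwo x, x i) := fun t i =>
    (hEm t).comp (measurable_id.prodMk (measurable_pi_apply i))
  have hρm : ∀ t, Measurable fun x : Fin (m + 2) → W => ρ {y | τ (firstTwo x) y = t} := fun t =>
    (measurable_measure_prodMk_left (hτ t)).comp measurable_firstTwo
  have hnew : ∀ x : Fin (m + 2) → W,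
      ∫⁻ y, S.indicator (1 : (Fin (m + 1 + 2) → W) → ℝ≥0∞) (Matrix.vecCons y x) ∂ρ =
        ∑ t, (D t).indicator 1 x * ρ {y | τ (firstTwo x) y = t} := by
    intro x
    simp_rw [hcons]
    have hmx : ∀ t, Measurable fun y => (E t).indicator (1 : (W × W) × W → ℝ≥0∞) (firstTwo x, y) :=
      fun t => (hEm t).comp measurable_prodMk_left
    rw [lintegral_finsetSum _ fun t _ => (hmx t).const_mul _]
    refine Finset.sum_congr rfl fun t _ => ?_
    rw [lintegral_const_mul _ (hmx t)]
    congr 1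
    exact lintegral_indicator_one (measurable_prodMk_left (hτ t))
  have hweight : ∀ t, ∀ x ∈ D t, ENNReal.ofReal θ * ρ {y | τ (firstTwo x) y = t} +
      ∑ i, (E t).indicator (1 : (W × W) × W → ℝ≥0∞) (firstTwo x, x i) = ENNReal.ofReal (w t + N t - 1) := by
    intro t x hx
    have h1 : ∀ i, (E t).indicator (1 : (W × W) × W → ℝ≥0∞) (firstTwo x, x i) =
        ((if τ (firstTwo x) (x i) = t then 1 else 0 : ℕ) : ℝ≥0∞) := by
      intro i
      by_cases h : τ (firstTwo x) (x i) = t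
      · rw [Set.indicator_of_mem (show _ ∈ E t from h), if_pos h]; simp
      · rw [Set.indicator_of_notMem (show _ ∉ E t from h), if_neg h]; simp
    have h2 : ∑ i, (if τ (firstTwo x) (x i) = t then 1 else 0 : ℕ) = typeCount τ x t +
        ((if τ (firstTwo x) (firstTwo x).1 = t then 1 else 0) +
          (if τ (firstTwo x) (firstTwo x).2 = t then 1 else 0)) := by
      rw [Fin.sum_univ_add, Fin.sum_univ_two, typeCount, Finset.card_filter]
      rfl
    have h3 : ((typeCount τ x t : ℤ) : ℝ) = N t - 1 := by rw [hx.2 t]; simp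
    rw [Finset.sum_congr rfl fun i _ => h1 i, ← Nat.cast_sum, h2, ← ofReal_measureReal,
      ← ENNReal.ofReal_mul hθ.le, ← ENNReal.ofReal_natCast, ← ENNReal.ofReal_add
      (by positivity) (by positivity), ← hw _ hx.1 t]
    congr 1
    rw [Int.cast_natCast] at h3
    push_cast
    rw [h3]
    ring
  have hmain : (polyaUrn θ ρ (m + 1 + 2)) S = ENNReal.ofReal (θ + (m + 2 : ℕ))⁻¹ *
      ∑ t, ENNReal.ofReal (w t + N t - 1) * polyaUrn θ ρ (m + 2) (D t) := by
    rw [← lintegral_indicator_one hSm]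
    refine (lintegral_polyaUrn_succ hθ (m + 2) (measurable_one.indicator hSm)).trans ?_
    congr 1
    simp_rw [hnew, hcons]
    have hm1 : ∀ t, Measurable fun x => (D t).indicator (1 : (Fin (m + 2) → W) → ℝ≥0∞) x *
        ρ {y | τ (firstTwo x) y = t} := fun t => (hDi t).mul (hρm t)
    have hm2 : ∀ t i, Measurable fun x => (D t).indicator (1 : (Fin (m + 2) → W) → ℝ≥0∞) x *
        (E t).indicator (1 : (W × W) × W → ℝ≥0∞) (firstTwo x, x i) :=
      fun t i => (hDi t).mul (hEi t i)
    rw [lintegral_finsetSum _ fun t _ => hm1 t,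
      Finset.sum_congr rfl fun i _ => lintegral_finsetSum _ fun t _ => hm2 t i,
      Finset.sum_comm, Finset.mul_sum, ← Finset.sum_add_distrib]
    refine Finset.sum_congr rfl fun t _ => ?_
    rw [← lintegral_const_mul _ (hm1 t), ← lintegral_finsetSum _ fun i _ => hm2 t i,
      ← lintegral_add_left ((hm1 t).const_mul _), ← lintegral_indicator_one (hDm t),
      ← lintegral_const_mul _ (hDi t)]
    refine lintegral_congr fun x => ?_
    by_cases hx : x ∈ D t
    · rw [← hweight t x hx]
      simp only [Set.indicator_of_mem hx, Pi.one_apply, one_mul, mul_one]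
    · simp [Set.indicator_of_notMem hx]
  have hpos : θ + (m + 2 : ℕ) ≠ 0 := by positivity
  rw [Measure.real, hmain, ENNReal.toReal_mul, ENNReal.toReal_ofReal (by positivity),
    ENNReal.toReal_sum fun t _ => by finiteness]
  rw [show θ + 2 + m = θ + (m + 2 : ℕ) by push_cast; ring, mul_inv_cancel_left₀ hpos]
  refine Finset.sum_congr rfl fun t _ => ?_
  rw [ENNReal.toReal_mul]
  -- The coefficient may be negative, where `ENNReal.ofReal` truncates it, but only when `D t` is
  -- empty; a point of `D t` exhibits it as `w t` plus a count.
  rcases (D t).eq_empty_or_nonempty with h | ⟨x, hx⟩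
  · change _ * _ = _ * (polyaUrn θ ρ (m + 2)).real (D t)
    simp [h]
  · rw [ENNReal.toReal_ofReal, Measure.real]
    have h3 : ((typeCount τ x t : ℤ) : ℝ) = N t - 1 := by rw [hx.2 t]; simp
    have h4 : 0 ≤ w t := by rw [← hw _ hx.1 t]; positivity
    rw [add_sub_assoc, ← h3]
    positivity

/-- Given the first two draws of a Pólya urn sequence, the type counts of the subsequent draws
have a Dirichlet-multinomial distribution. -/
theorem polyaUrn_typeCount (hθ : 0 < θ)
    (hτ : ∀ t, MeasurableSet {p : (W × W) × W | τ p.1 p.2 = t}) (hσ : MeasurableSet σ)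
    (hw : ∀ u ∈ σ, ∀ t, θ * ρ.real {y | τ u y = t} +
      ((if τ u u.1 = t then 1 else 0) + (if τ u u.2 = t then 1 else 0)) = w t)
    (m : ℕ) (N : T → ℤ) (hN : ∑ t, N t = m) :
    (polyaUrn θ ρ (m + 2)).real {z | firstTwo z ∈ σ ∧ ∀ t, (typeCount τ z t : ℤ) = N t} =
      (polyaUrn θ ρ 2).real {z | (z 0, z 1) ∈ σ} * (m.factorial / rising (θ + 2) m) *
        ∏ t, risingOverFactorial (w t) (N t) := by
  induction m generalizing N with
  | zero =>
    have hc : ∀ (z : Fin (0 + 2) → W) t, typeCount τ z t = 0 := by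
      intro z t; simp [typeCount]
    by_cases h0 : N = 0
    · subst h0
      have hset : {z : Fin (0 + 2) → W | firstTwo z ∈ σ ∧
          ∀ t, (typeCount τ z t : ℤ) = (0 : T → ℤ) t} = {z | (z 0, z 1) ∈ σ} := by
        ext z
        simp only [hc, Pi.zero_apply, Nat.cast_zero, implies_true, and_true, Set.mem_ofPred_eq]
        rfl
      rw [hset]
      simp [rising_zero, risingOverFactorial]
    -- Nonzero integers summing to 0 include a negative one, which makes both the event empty and
    -- the product zero.
    · obtain ⟨t, ht⟩ : ∃ t, N t < 0 := by
        by_contra! h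
        refine h0 (funext fun t => ?_)
        exact (Finset.sum_eq_zero_iff_of_nonneg fun t _ => h t).1 (by simpa using hN) t
          (Finset.mem_univ t)
      have hset : {z : Fin (0 + 2) → W | firstTwo z ∈ σ ∧
          ∀ t, (typeCount τ z t : ℤ) = N t} = ∅ := by
        ext z
        simp only [hc, Set.mem_ofPred_eq, Set.mem_empty_iff_false, iff_false, not_and]
        intro _ h
        have := h t
        omega
      rw [hset, Finset.prod_eq_zero (Finset.mem_univ t) (by simp [risingOverFactorial, ht.not_ge])]
      simp
  | succ m ih =>
    have hpos : θ + 2 + m ≠ 0 := by positivity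
    have hr := (rising_pos (show 0 < θ + 2 by positivity) m).ne'
    -- Each predecessor term is `N t` times the target product, so summing over `t` yields the
    -- factor `∑ N t = m + 1` that completes the factorial.
    have hterm : ∀ t, (w t + N t - 1) *
        ∏ s, risingOverFactorial (w s) (N s - if s = t then 1 else 0) =
        N t * ∏ s, risingOverFactorial (w s) (N s) := by
      intro t
      rw [← Finset.mul_prod_erase _ _ (Finset.mem_univ t),
        ← Finset.mul_prod_erase _ (fun s => risingOverFactorial (w s) (N s))
          (Finset.mem_univ t), if_pos rfl, ← mul_assoc, ← mul_assoc, mul_risingOverFactorial]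
      congr 1
      refine Finset.prod_congr rfl fun s hs => ?_
      rw [if_neg (Finset.ne_of_mem_erase hs), sub_zero]
    refine mul_left_cancel₀ hpos ?_
    rw [polyaUrn_typeCount_succ hθ hτ hσ hw]
    have hsum : ∀ t, ∑ s, (N s - if s = t then 1 else 0) = m := by
      intro t
      rw [Finset.sum_sub_distrib, hN]
      simp
    have hNr : ∑ t, (N t : ℝ) = m + 1 := by exact_mod_cast hN
    calc _ = ∑ t, (polyaUrn θ ρ 2).real {z | (z 0, z 1) ∈ σ} * (m.factorial / rising (θ + 2) m) *
          (N t * ∏ s, risingOverFactorial (w s) (N s)) := by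
          refine Finset.sum_congr rfl fun t _ => ?_
          rw [ih _ (hsum t), ← hterm t]
          ring
      _ = _ := by
          rw [← Finset.mul_sum, ← Finset.sum_mul, hNr, rising_succ, Nat.factorial_succ]
          push_cast
          field_simp

end UrnCounts

/-- The second draw is fresh with probability `θ/(θ+1)`, giving `p` whatever the first draw `x` was,
and otherwise copies the first draw, giving `q`. -/
theorem polyaUrn_two {W : Type*} [MeasurableSpace W] {θ : ℝ} (hθ : 0 < θ) {ρ : Measure W}
    [IsProbabilityMeasure ρ] {σ : Set (W × W)} (hσ : MeasurableSet σ) {p q : ℝ}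
    (hp : ∀ x, ρ.real {y | (y, x) ∈ σ} = p) (hq : ρ.real {x | (x, x) ∈ σ} = q) :
    (polyaUrn θ ρ 2).real {z | (z 0, z 1) ∈ σ} = (θ * p + q) / (θ + 1) := by
  have h0 : 0 ≤ p := by
    obtain ⟨x⟩ : Nonempty W := nonempty_of_isProbabilityMeasure ρ
    rw [← hp x]; positivity
  have h1 : 0 ≤ q := by rw [← hq]; positivity
  have hS : MeasurableSet {z : Fin 2 → W | (z 0, z 1) ∈ σ} :=
    (Measurable.prodMk (by fun_prop) (by fun_prop)) hσ
  have hF : Measurable ({z : Fin 2 → W | (z 0, z 1) ∈ σ}.indicator (1 : (Fin 2 → W) → ℝ≥0∞)) :=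
    measurable_one.indicator hS
  have := isProbabilityMeasure_polyaUrn (ρ := ρ) hθ 1
  have hnew : ∀ x : Fin 1 → W, ∫⁻ y, {z : Fin 2 → W | (z 0, z 1) ∈ σ}.indicator
      (1 : (Fin 2 → W) → ℝ≥0∞) (Matrix.vecCons y x) ∂ρ = ENNReal.ofReal p := by
    intro x
    have hd : MeasurableSet {y | (y, x 0) ∈ σ} := measurable_prodMk_right hσ
    rw [← hp (x 0), ofReal_measureReal, ← lintegral_indicator_one hd]
    rfl
  have hold : ∫⁻ x, {z : Fin 2 → W | (z 0, z 1) ∈ σ}.indicator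
      (1 : (Fin 2 → W) → ℝ≥0∞) (Matrix.vecCons (x 0) x) ∂polyaUrn θ ρ 1 = ENNReal.ofReal q := by
    have hm : Measurable fun x : Fin 1 → W => {z : Fin 2 → W | (z 0, z 1) ∈ σ}.indicator
      (1 : (Fin 2 → W) → ℝ≥0∞) (Matrix.vecCons (x 0) x) := hF.comp (measurable_vecCons_self 0)
    have hd : MeasurableSet {x | (x, x) ∈ σ} := (measurable_id.prodMk measurable_id) hσ
    have hin : ∀ x : Fin 0 → W, ∫⁻ y, {z : Fin 2 → W | (z 0, z 1) ∈ σ}.indicator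
        (1 : (Fin 2 → W) → ℝ≥0∞) (Matrix.vecCons (Matrix.vecCons y x 0) (Matrix.vecCons y x)) ∂ρ =
        ENNReal.ofReal q := by
      intro x
      rw [← hq, ofReal_measureReal, ← lintegral_indicator_one hd]
      rfl
    have := isProbabilityMeasure_polyaUrn (ρ := ρ) hθ 0
    rw [lintegral_polyaUrn_succ hθ 0 hm]
    simp_rw [hin]
    rw [lintegral_const, measure_univ, mul_one, Finset.univ_eq_empty, Finset.sum_empty, add_zero,
      Nat.cast_zero, add_zero, ← mul_assoc, ← ENNReal.ofReal_mul (by positivity),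
      inv_mul_cancel₀ hθ.ne', ENNReal.ofReal_one, one_mul]
  rw [Measure.real, ← lintegral_indicator_one hS, lintegral_polyaUrn_succ hθ 1 hF]
  simp_rw [hnew]
  rw [lintegral_const, measure_univ, mul_one, Fin.sum_univ_one, hold, ← ENNReal.ofReal_mul hθ.le,
    ← ENNReal.ofReal_add (by positivity) h1, ← ENNReal.ofReal_mul (by positivity),
    ENNReal.toReal_ofReal (by positivity)]
  simp [div_eq_inv_mul]

/-! ### Masses of bucket sets and special rising factorials -/

section Buckets

variable {V : Type*} [MeasurableSpace V] {J : ℕ}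

/-- The two excluded values, those of the queries in the applications, are `ν`-null, so only the
bucket condition contributes mass. -/
theorem real_prod_uniformBucket (hJ : 1 ≤ J) {ν : Measure V} [IsProbabilityMeasure ν]
    [NullSingletonClass ν] (a b : V) (p : Fin J → Prop) [DecidablePred p] {S : Set (V × Fin J)}
    (hS : ∀ y, y.1 ≠ a → y.1 ≠ b → (y ∈ S ↔ p y.2)) :
    (ν.prod (uniformBucket J)).real S = ((Finset.univ.filter p).card : ℝ) / J := by
  have := isProbabilityMeasure_uniformBucket hJ
  have hne : ∀ a, ∀ᵐ y ∂ν.prod (uniformBucket J), y.1 ≠ a := fun a =>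
    Measure.quasiMeasurePreserving_fst.ae
      ((measure_eq_zero_iff_ae_notMem.1 (measure_singleton (μ := ν) a)).mono fun y hy => hy)
  have hae : S =ᵐ[ν.prod (uniformBucket J)] Set.univ ×ˢ {c | p c} := by
    filter_upwards [hne a, hne b] with y ha hb
    exact propext ((hS y ha hb).trans ⟨fun h => ⟨trivial, h⟩, fun h => h.2⟩)
  rw [measureReal_congr hae, measureReal_prod_prod, probReal_univ, one_mul, uniformBucket,
    measureReal_ennreal_smul_apply, Measure.real, Measure.count_apply MeasurableSet.of_discrete]
  simp [Set.encard_eq_coe_toFinset_card, div_eq_inv_mul]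

theorem card_filter_bucket_ne (b : Fin J) :
    ((Finset.univ.filter fun c => c ≠ b).card : ℝ) = J - 1 := by
  have hJ : 1 ≤ J := Nat.one_le_iff_ne_zero.2 fun h => (h ▸ b).elim0
  rw [Finset.filter_ne', Finset.card_erase_of_mem (Finset.mem_univ b), Finset.card_univ,
    Fintype.card_fin]
  push_cast [hJ]
  rfl

theorem card_filter_bucket_ne_ne {b b' : Fin J} (h : b ≠ b') :
    ((Finset.univ.filter fun c => c ≠ b ∧ c ≠ b').card : ℝ) = J - 2 := by
  have hJ : 2 ≤ J := by
    have := Finset.card_le_univ {b, b'}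
    rwa [Finset.card_pair h, Fintype.card_fin] at this
  have : (Finset.univ.filter fun c => c ≠ b ∧ c ≠ b') = (Finset.univ.erase b).erase b' := by
    ext c; simp [and_comm]
  rw [this, Finset.card_erase_of_mem (by simp [h.symm]),
    Finset.card_erase_of_mem (Finset.mem_univ b), Finset.card_univ, Fintype.card_fin,
    Nat.sub_sub]
  push_cast [hJ]
  rfl

end Buckets

/-- The type of a query's value has no base mass; its weight is 1, or 2 if both queries share the
value. These evaluations give the factors `1` and `l + 1` in `Num`. -/
theorem risingOverFactorial_one (l : ℕ) : risingOverFactorial 1 l = 1 := by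
  have h : rising 1 l = l.factorial := by
    induction l with
    | zero => simp [rising_zero]
    | succ l ih => rw [rising_succ, ih, Nat.factorial_succ]; push_cast; ring
  have := (Nat.cast_pos (α := ℝ).2 l.factorial_pos).ne'
  simp [risingOverFactorial, h, this]

theorem risingOverFactorial_two (l : ℕ) : risingOverFactorial 2 l = l + 1 := by
  have h : rising 2 l = (l + 1 : ℝ) * l.factorial := by
    induction l with
    | zero => simp [rising_zero]
    | succ l ih => rw [rising_succ, ih, Nat.factorial_succ]; push_cast; ring
  have := (Nat.cast_pos (α := ℝ).2 l.factorial_pos).ne'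
  simp only [risingOverFactorial, Int.natCast_nonneg, if_true, Int.toNat_natCast, h]
  field_simp

theorem sum_typeCount {W T : Type*} [Fintype T] [DecidableEq T] {m : ℕ} (τ : W × W → W → T)
    (z : Fin (m + 2) → W) : ∑ t, typeCount τ z t = m := by
  simp only [typeCount]
  rw [← Finset.card_eq_sum_card_fiberwise (fun _ _ => Finset.mem_coe.2 (Finset.mem_univ _))]
  simp

/-! ### Types of draws relative to the two queries -/

section Classification

variable {V : Type*} {J : ℕ}

open Classical in
/-- Types of the draws when the first two draws have the same value. -/
noncomputable def classifyEq (u : (V × Fin J) × (V × Fin J)) (y : V × Fin J) : Fin 3 :=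
  if y.1 = u.1.1 then 0 else if y.2 = u.1.2 then 1 else 2

open Classical in
/-- Types of the draws when the first two draws have distinct values in the same bucket. -/
noncomputable def classifySame (u : (V × Fin J) × (V × Fin J)) (y : V × Fin J) : Fin 4 :=
  if y.1 = u.1.1 then 0 else if y.1 = u.2.1 then 1 else if y.2 = u.1.2 then 2 else 3

open Classical in
/-- Types of the draws when the first two draws are in distinct buckets. -/
noncomputable def classifyDiff (u : (V × Fin J) × (V × Fin J)) (y : V × Fin J) : Fin 5 :=
  if y.1 = u.1.1 then 0 else if y.1 = u.2.1 then 1 else if y.2 = u.1.2 then 2 else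
    if y.2 = u.2.2 then 3 else 4

/-- Types of the draws by bucket, when the first two draws are in the same bucket. -/
def classifyBucket (u : (V × Fin J) × (V × Fin J)) (y : V × Fin J) : Fin 2 :=
  if y.2 = u.1.2 then 0 else 1

/-- Types of the draws by bucket, when the first two draws are in distinct buckets. -/
def classifyBuckets (u : (V × Fin J) × (V × Fin J)) (y : V × Fin J) : Fin 3 :=
  if y.2 = u.1.2 then 0 else if y.2 = u.2.2 then 1 else 2

variable [MeasurableSpace V]

theorem measurable_classifyBucket : Measurable
    fun p : ((V × Fin J) × (V × Fin J)) × (V × Fin J) => classifyBucket p.1 p.2 := by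
  unfold classifyBucket
  exact .ite (measurableSet_eq_fun (by fun_prop) (by fun_prop)) measurable_const measurable_const

theorem measurable_classifyBuckets : Measurable
    fun p : ((V × Fin J) × (V × Fin J)) × (V × Fin J) => classifyBuckets p.1 p.2 := by
  unfold classifyBuckets
  exact .ite (measurableSet_eq_fun (by fun_prop) (by fun_prop)) measurable_const
    (.ite (measurableSet_eq_fun (by fun_prop) (by fun_prop)) measurable_const measurable_const)

variable [MeasurableEq V]

theorem measurable_classifyEq : Measurable
    fun p : ((V × Fin J) × (V × Fin J)) × (V × Fin J) => classifyEq p.1 p.2 := by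
  unfold classifyEq
  exact .ite (measurableSet_eq_fun (by fun_prop) (by fun_prop)) measurable_const
    (.ite (measurableSet_eq_fun (by fun_prop) (by fun_prop)) measurable_const measurable_const)

theorem measurable_classifySame : Measurable
    fun p : ((V × Fin J) × (V × Fin J)) × (V × Fin J) => classifySame p.1 p.2 := by
  unfold classifySame
  exact .ite (measurableSet_eq_fun (by fun_prop) (by fun_prop)) measurable_const
    (.ite (measurableSet_eq_fun (by fun_prop) (by fun_prop)) measurable_const
    (.ite (measurableSet_eq_fun (by fun_prop) (by fun_prop)) measurable_const measurable_const))

theorem measurable_classifyDiff : Measurable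
    fun p : ((V × Fin J) × (V × Fin J)) × (V × Fin J) => classifyDiff p.1 p.2 := by
  unfold classifyDiff
  exact .ite (measurableSet_eq_fun (by fun_prop) (by fun_prop)) measurable_const
    (.ite (measurableSet_eq_fun (by fun_prop) (by fun_prop)) measurable_const
    (.ite (measurableSet_eq_fun (by fun_prop) (by fun_prop)) measurable_const
    (.ite (measurableSet_eq_fun (by fun_prop) (by fun_prop)) measurable_const measurable_const)))

end Classification

/-! ### Frequencies as type counts -/

section Counts

variable {Ω V : Type*} {m J : ℕ} (h : Ω → V → Fin J) (X : Fin (m + 2) → Ω → V)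

/-- The sample together with the hashed values. -/
def hashedSample (ω : Ω) (i : Fin (m + 2)) : V × Fin J := (X i ω, h ω (X i ω))

variable {h X} {ω : Ω}

/-- In a hashed sample equal values have equal buckets, so draws equal to a query also count in its
bucket. An arbitrary sequence in `V × Fin J` need not have this property. -/
theorem counts_classifyEq (hx : (firstTwo (hashedSample h X ω)).1.1 =
      (firstTwo (hashedSample h X ω)).2.1) :
    freq X 0 ω = typeCount classifyEq (hashedSample h X ω) 0 ∧
    freq X 1 ω = typeCount classifyEq (hashedSample h X ω) 0 ∧
    hashedFreq h X 0 ω = typeCount classifyEq (hashedSample h X ω) 0 +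
      typeCount classifyEq (hashedSample h X ω) 1 ∧
    hashedFreq h X 1 ω = typeCount classifyEq (hashedSample h X ω) 0 +
      typeCount classifyEq (hashedSample h X ω) 1 := by
  simp only [freq, hashedFreq, typeCount, Finset.card_filter, ← Finset.sum_add_distrib]
  simp only [firstTwo, hashedSample, classifyEq] at hx ⊢
  refine ⟨?_, ?_, ?_, ?_⟩ <;> refine Finset.sum_congr rfl fun i _ => ?_ <;> grind

theorem counts_classifySame (hx : (firstTwo (hashedSample h X ω)).1.1 ≠
      (firstTwo (hashedSample h X ω)).2.1)
    (hb : (firstTwo (hashedSample h X ω)).1.2 = (firstTwo (hashedSample h X ω)).2.2) :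
    freq X 0 ω = typeCount classifySame (hashedSample h X ω) 0 ∧
    freq X 1 ω = typeCount classifySame (hashedSample h X ω) 1 ∧
    hashedFreq h X 0 ω = typeCount classifySame (hashedSample h X ω) 0 +
      typeCount classifySame (hashedSample h X ω) 1 +
      typeCount classifySame (hashedSample h X ω) 2 ∧
    hashedFreq h X 1 ω = typeCount classifySame (hashedSample h X ω) 0 +
      typeCount classifySame (hashedSample h X ω) 1 +
      typeCount classifySame (hashedSample h X ω) 2 := by
  simp only [freq, hashedFreq, typeCount, Finset.card_filter, ← Finset.sum_add_distrib]
  simp only [firstTwo, hashedSample, classifySame] at hx hb ⊢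
  refine ⟨?_, ?_, ?_, ?_⟩ <;> refine Finset.sum_congr rfl fun i _ => ?_ <;> grind

theorem counts_classifyDiff
    (hb : (firstTwo (hashedSample h X ω)).1.2 ≠ (firstTwo (hashedSample h X ω)).2.2) :
    freq X 0 ω = typeCount classifyDiff (hashedSample h X ω) 0 ∧
    freq X 1 ω = typeCount classifyDiff (hashedSample h X ω) 1 ∧
    hashedFreq h X 0 ω = typeCount classifyDiff (hashedSample h X ω) 0 +
      typeCount classifyDiff (hashedSample h X ω) 2 ∧
    hashedFreq h X 1 ω = typeCount classifyDiff (hashedSample h X ω) 1 +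
      typeCount classifyDiff (hashedSample h X ω) 3 := by
  simp only [freq, hashedFreq, typeCount, Finset.card_filter, ← Finset.sum_add_distrib]
  simp only [firstTwo, hashedSample, classifyDiff] at hb ⊢
  refine ⟨?_, ?_, ?_, ?_⟩ <;> refine Finset.sum_congr rfl fun i _ => ?_ <;> grind

theorem counts_classifyBucket
    (hb : (firstTwo (hashedSample h X ω)).1.2 = (firstTwo (hashedSample h X ω)).2.2) :
    hashedFreq h X 0 ω = typeCount classifyBucket (hashedSample h X ω) 0 ∧
    hashedFreq h X 1 ω = typeCount classifyBucket (hashedSample h X ω) 0 := by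
  simp only [hashedFreq, typeCount, Finset.card_filter]
  simp only [firstTwo, hashedSample, classifyBucket] at hb ⊢
  refine ⟨?_, ?_⟩ <;> refine Finset.sum_congr rfl fun i _ => ?_ <;> grind

theorem counts_classifyBuckets
    (hb : (firstTwo (hashedSample h X ω)).1.2 ≠ (firstTwo (hashedSample h X ω)).2.2) :
    hashedFreq h X 0 ω = typeCount classifyBuckets (hashedSample h X ω) 0 ∧
    hashedFreq h X 1 ω = typeCount classifyBuckets (hashedSample h X ω) 1 := by
  simp only [hashedFreq, typeCount, Finset.card_filter]
  simp only [firstTwo, hashedSample, classifyBuckets] at hb ⊢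
  refine ⟨?_, ?_⟩ <;> refine Finset.sum_congr rfl fun i _ => ?_ <;> grind

end Counts

/-! ### Urn probabilities for each configuration of the queries -/

section Probabilities

variable {V : Type*} [MeasurableSpace V] {J : ℕ} {ν : Measure V}
  [IsProbabilityMeasure ν] [NullSingletonClass ν] {θ : ℝ} {m : ℕ}

theorem polyaUrn_classifyBucket (hθ : 0 < θ) (hJ : 1 ≤ J) (N : Fin 2 → ℤ) (hN : ∑ t, N t = m) :
    (polyaUrn θ (ν.prod (uniformBucket J)) (m + 2)).real
      {z | firstTwo z ∈ {u | u.1.2 = u.2.2} ∧ ∀ t, (typeCount classifyBucket z t : ℤ) = N t} =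
      (θ / J + 1) / (θ + 1) * (m.factorial / rising (θ + 2) m) *
        (risingOverFactorial (θ / J + 2) (N 0) * risingOverFactorial (θ - θ / J) (N 1)) := by
  have := isProbabilityMeasure_uniformBucket hJ
  have hJ' : (J : ℝ) ≠ 0 := by positivity
  have hσ : MeasurableSet {u : (V × Fin J) × (V × Fin J) | u.1.2 = u.2.2} :=
    measurableSet_eq_fun (by fun_prop) (by fun_prop)
  rw [polyaUrn_typeCount hθ (fun t => measurable_classifyBucket (measurableSet_singleton t)) hσ
    (w := ![θ / J + 2, θ - θ / J]) ?_ m N hN, polyaUrn_two hθ hσ (p := 1 / J) (q := 1)]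
  · simp [Fin.prod_univ_two, div_eq_mul_inv]
  · intro x
    rw [real_prod_uniformBucket hJ x.1 x.1 (fun c => c = x.2) (fun y hy _ => by simp)]
    simp [Finset.filter_eq']
  · simp
  · intro u hu t
    have h1 : classifyBucket u u.1 = 0 := by simp [classifyBucket]
    have h2 : classifyBucket u u.2 = 0 := by simp [classifyBucket, show u.1.2 = u.2.2 from hu]
    rw [h1, h2]
    match t with
    | 0 =>
      rw [real_prod_uniformBucket hJ u.1.1 u.1.1 (fun c => c = u.1.2) (fun y _ _ => by
        simp only [classifyBucket, Set.mem_ofPred_eq]; grind)]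
      simp [Finset.filter_eq', div_eq_mul_inv]
      norm_num
    | 1 =>
      rw [real_prod_uniformBucket hJ u.1.1 u.1.1 (fun c => c ≠ u.1.2) (fun y _ _ => by
        simp only [classifyBucket, Set.mem_ofPred_eq]; grind), card_filter_bucket_ne]
      simp
      field_simp

/-- For `J = 1` the weight `θ - 2θ/J` is negative, but then no two buckets differ, the condition on
weights is vacuous, and both sides vanish. -/
theorem polyaUrn_classifyBuckets (hθ : 0 < θ) (hJ : 1 ≤ J) (N : Fin 3 → ℤ)
    (hN : ∑ t, N t = m) :
    (polyaUrn θ (ν.prod (uniformBucket J)) (m + 2)).real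
      {z | firstTwo z ∈ {u | u.1.2 ≠ u.2.2} ∧ ∀ t, (typeCount classifyBuckets z t : ℤ) = N t} =
      θ * ((J - 1) / J) / (θ + 1) * (m.factorial / rising (θ + 2) m) *
        (risingOverFactorial (θ / J + 1) (N 0) * risingOverFactorial (θ / J + 1) (N 1) *
          risingOverFactorial (θ - 2 * θ / J) (N 2)) := by
  have := isProbabilityMeasure_uniformBucket hJ
  have hJ' : (J : ℝ) ≠ 0 := by positivity
  have hσ : MeasurableSet {u : (V × Fin J) × (V × Fin J) | u.1.2 ≠ u.2.2} :=
    (measurableSet_eq_fun (by fun_prop) (by fun_prop)).compl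
  rw [polyaUrn_typeCount hθ (fun t => measurable_classifyBuckets (measurableSet_singleton t)) hσ
    (w := ![θ / J + 1, θ / J + 1, θ - 2 * θ / J]) ?_ m N hN,
    polyaUrn_two hθ hσ (p := (J - 1) / J) (q := 0)]
  · simp [Fin.prod_univ_three]
  · intro x
    rw [real_prod_uniformBucket hJ x.1 x.1 (fun c => c ≠ x.2) (fun y hy _ => by simp),
      card_filter_bucket_ne]
  · simp
  · intro u hu t
    have hb : u.1.2 ≠ u.2.2 := hu
    have h1 : classifyBuckets u u.1 = 0 := by simp [classifyBuckets]
    have h2 : classifyBuckets u u.2 = 1 := by simp [classifyBuckets, hb.symm]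
    rw [h1, h2]
    match t with
    | 0 =>
      rw [real_prod_uniformBucket hJ u.1.1 u.1.1 (fun c => c = u.1.2) (fun y _ _ => by
        simp only [classifyBuckets, Set.mem_ofPred_eq]; grind)]
      simp [Finset.filter_eq', div_eq_mul_inv]
    | 1 =>
      rw [real_prod_uniformBucket hJ u.1.1 u.1.1 (fun c => c = u.2.2) (fun y _ _ => by
        simp only [classifyBuckets, Set.mem_ofPred_eq]; grind)]
      simp [Finset.filter_eq', div_eq_mul_inv]
    | 2 =>
      rw [real_prod_uniformBucket hJ u.1.1 u.1.1 (fun c => c ≠ u.1.2 ∧ c ≠ u.2.2)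
        (fun y _ _ => by simp only [classifyBuckets, Set.mem_ofPred_eq]; grind),
        card_filter_bucket_ne_ne hb]
      simp
      field_simp

variable [MeasurableEq V]

/-- By non-atomicity the queries agree only through copying, so `p = 0` and `q = 1`. Type 0 has
weight 2, both queries being of that type. -/
theorem polyaUrn_classifyEq (hθ : 0 < θ) (hJ : 1 ≤ J) (N : Fin 3 → ℤ) (hN : ∑ t, N t = m) :
    (polyaUrn θ (ν.prod (uniformBucket J)) (m + 2)).real
      {z | firstTwo z ∈ {u | u.1.1 = u.2.1} ∧ ∀ t, (typeCount classifyEq z t : ℤ) = N t} =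
      1 / (θ + 1) * (m.factorial / rising (θ + 2) m) * (risingOverFactorial 2 (N 0) *
        risingOverFactorial (θ / J) (N 1) * risingOverFactorial (θ - θ / J) (N 2)) := by
  have := isProbabilityMeasure_uniformBucket hJ
  have hJ' : (J : ℝ) ≠ 0 := by positivity
  have hσ : MeasurableSet {u : (V × Fin J) × (V × Fin J) | u.1.1 = u.2.1} :=
    measurableSet_eq_fun (by fun_prop) (by fun_prop)
  rw [polyaUrn_typeCount hθ (fun t => measurable_classifyEq (measurableSet_singleton t)) hσ
    (w := ![2, θ / J, θ - θ / J]) ?_ m N hN, polyaUrn_two hθ hσ (p := 0) (q := 1)]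
  · simp [Fin.prod_univ_three]
  · intro x
    rw [real_prod_uniformBucket hJ x.1 x.1 (fun _ => False) (fun y hy _ => by simpa using hy)]
    simp
  · simp
  · intro u hu t
    have h1 : classifyEq u u.1 = 0 := by simp [classifyEq]
    have h2 : classifyEq u u.2 = 0 := by simp [classifyEq, show u.1.1 = u.2.1 from hu]
    rw [h1, h2]
    match t with
    | 0 =>
      rw [real_prod_uniformBucket hJ u.1.1 u.1.1 (fun _ => False) (fun y hy _ => by
        simp only [classifyEq, Set.mem_ofPred_eq]; grind)]
      norm_num
    | 1 =>
      rw [real_prod_uniformBucket hJ u.1.1 u.1.1 (fun c => c = u.1.2) (fun y hy _ => by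
        simp only [classifyEq, Set.mem_ofPred_eq]; grind)]
      simp [Finset.filter_eq', div_eq_mul_inv]
    | 2 =>
      rw [real_prod_uniformBucket hJ u.1.1 u.1.1 (fun c => c ≠ u.1.2) (fun y hy _ => by
        simp only [classifyEq, Set.mem_ofPred_eq]; grind), card_filter_bucket_ne]
      simp
      field_simp

theorem polyaUrn_classifySame (hθ : 0 < θ) (hJ : 1 ≤ J) (N : Fin 4 → ℤ) (hN : ∑ t, N t = m) :
    (polyaUrn θ (ν.prod (uniformBucket J)) (m + 2)).real
      {z | firstTwo z ∈ {u | u.1.1 ≠ u.2.1 ∧ u.1.2 = u.2.2} ∧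
        ∀ t, (typeCount classifySame z t : ℤ) = N t} =
      θ / J / (θ + 1) * (m.factorial / rising (θ + 2) m) * (risingOverFactorial 1 (N 0) *
        risingOverFactorial 1 (N 1) * risingOverFactorial (θ / J) (N 2) *
        risingOverFactorial (θ - θ / J) (N 3)) := by
  have := isProbabilityMeasure_uniformBucket hJ
  have hJ' : (J : ℝ) ≠ 0 := by positivity
  have hσ : MeasurableSet {u : (V × Fin J) × (V × Fin J) | u.1.1 ≠ u.2.1 ∧ u.1.2 = u.2.2} :=
    (measurableSet_eq_fun (by fun_prop) (by fun_prop)).compl.inter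
      (measurableSet_eq_fun (by fun_prop) (by fun_prop))
  rw [polyaUrn_typeCount hθ (fun t => measurable_classifySame (measurableSet_singleton t)) hσ
    (w := ![1, 1, θ / J, θ - θ / J]) ?_ m N hN, polyaUrn_two hθ hσ (p := 1 / J) (q := 0)]
  · simp [Fin.prod_univ_four, div_eq_mul_inv]
  · intro x
    rw [real_prod_uniformBucket hJ x.1 x.1 (fun c => c = x.2) (fun y hy _ => by simp [hy])]
    simp [Finset.filter_eq']
  · simp
  · intro u hu t
    obtain ⟨hx, hb⟩ : u.1.1 ≠ u.2.1 ∧ u.1.2 = u.2.2 := hu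
    have h1 : classifySame u u.1 = 0 := by simp [classifySame]
    have h2 : classifySame u u.2 = 1 := by simp [classifySame, hx.symm]
    rw [h1, h2]
    match t with
    | 0 =>
      rw [real_prod_uniformBucket hJ u.1.1 u.2.1 (fun _ => False) (fun y hy hy' => by
        simp only [classifySame, Set.mem_ofPred_eq]; grind)]
      simp
    | 1 =>
      rw [real_prod_uniformBucket hJ u.1.1 u.2.1 (fun _ => False) (fun y hy hy' => by
        simp only [classifySame, Set.mem_ofPred_eq]; grind)]
      simp
    | 2 =>
      rw [real_prod_uniformBucket hJ u.1.1 u.2.1 (fun c => c = u.1.2) (fun y hy hy' => by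
        simp only [classifySame, Set.mem_ofPred_eq]; grind)]
      simp [Finset.filter_eq', div_eq_mul_inv]
    | 3 =>
      rw [real_prod_uniformBucket hJ u.1.1 u.2.1 (fun c => c ≠ u.1.2) (fun y hy hy' => by
        simp only [classifySame, Set.mem_ofPred_eq]; grind), card_filter_bucket_ne]
      simp
      field_simp

theorem polyaUrn_classifyDiff (hθ : 0 < θ) (hJ : 1 ≤ J) (N : Fin 5 → ℤ) (hN : ∑ t, N t = m) :
    (polyaUrn θ (ν.prod (uniformBucket J)) (m + 2)).real
      {z | firstTwo z ∈ {u | u.1.1 ≠ u.2.1 ∧ u.1.2 ≠ u.2.2} ∧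
        ∀ t, (typeCount classifyDiff z t : ℤ) = N t} =
      θ * ((J - 1) / J) / (θ + 1) * (m.factorial / rising (θ + 2) m) *
        (risingOverFactorial 1 (N 0) * risingOverFactorial 1 (N 1) *
          risingOverFactorial (θ / J) (N 2) * risingOverFactorial (θ / J) (N 3) *
          risingOverFactorial (θ - 2 * θ / J) (N 4)) := by
  have := isProbabilityMeasure_uniformBucket hJ
  have hJ' : (J : ℝ) ≠ 0 := by positivity
  have hσ : MeasurableSet {u : (V × Fin J) × (V × Fin J) | u.1.1 ≠ u.2.1 ∧ u.1.2 ≠ u.2.2} :=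
    (measurableSet_eq_fun (by fun_prop) (by fun_prop)).compl.inter
      (measurableSet_eq_fun (by fun_prop) (by fun_prop)).compl
  rw [polyaUrn_typeCount hθ (fun t => measurable_classifyDiff (measurableSet_singleton t)) hσ
    (w := ![1, 1, θ / J, θ / J, θ - 2 * θ / J]) ?_ m N hN,
    polyaUrn_two hθ hσ (p := (J - 1) / J) (q := 0)]
  · simp [Fin.prod_univ_five]
  · intro x
    rw [real_prod_uniformBucket hJ x.1 x.1 (fun c => c ≠ x.2) (fun y hy _ => by simp [hy]),
      card_filter_bucket_ne]
  · simp
  · intro u hu t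
    obtain ⟨hx, hb⟩ : u.1.1 ≠ u.2.1 ∧ u.1.2 ≠ u.2.2 := hu
    have h1 : classifyDiff u u.1 = 0 := by simp [classifyDiff]
    have h2 : classifyDiff u u.2 = 1 := by simp [classifyDiff, hx.symm]
    rw [h1, h2]
    match t with
    | 0 =>
      rw [real_prod_uniformBucket hJ u.1.1 u.2.1 (fun _ => False) (fun y hy hy' => by
        simp only [classifyDiff, Set.mem_ofPred_eq]; grind)]
      simp
    | 1 =>
      rw [real_prod_uniformBucket hJ u.1.1 u.2.1 (fun _ => False) (fun y hy hy' => by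
        simp only [classifyDiff, Set.mem_ofPred_eq]; grind)]
      simp
    | 2 =>
      rw [real_prod_uniformBucket hJ u.1.1 u.2.1 (fun c => c = u.1.2) (fun y hy hy' => by
        simp only [classifyDiff, Set.mem_ofPred_eq]; grind)]
      simp [Finset.filter_eq', div_eq_mul_inv]
    | 3 =>
      rw [real_prod_uniformBucket hJ u.1.1 u.2.1 (fun c => c = u.2.2) (fun y hy hy' => by
        simp only [classifyDiff, Set.mem_ofPred_eq]; grind)]
      simp [Finset.filter_eq', div_eq_mul_inv]
    | 4 =>
      rw [real_prod_uniformBucket hJ u.1.1 u.2.1 (fun c => c ≠ u.1.2 ∧ c ≠ u.2.2)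
        (fun y hy hy' => by simp only [classifyDiff, Set.mem_ofPred_eq]; grind),
        card_filter_bucket_ne_ne hb]
      simp
      field_simp

end Probabilities

theorem risingOverFactorial_natCast (a : ℝ) (n : ℕ) :
    risingOverFactorial a n = rising a n / n.factorial := by
  simp [risingOverFactorial]

/-- The joint law of the frequencies and the hashed frequencies is `posteriorFactor θ m` times the
numerator of the posterior. -/
noncomputable def posteriorFactor (θ : ℝ) (m : ℕ) : ℝ :=
  m.factorial / rising (θ + 2) m / (θ * (θ + 1))

theorem posteriorFactor_pos {θ : ℝ} (hθ : 0 < θ) (m : ℕ) : 0 < posteriorFactor θ m := by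
  have := rising_pos (show 0 < θ + 2 by positivity) m
  unfold posteriorFactor
  positivity

/-! ### Joint laws of the counts as `Den` and `Num` -/

section JointLaw

variable {Ω V : Type*} [MeasurableSpace Ω] [MeasurableSpace V] {m J : ℕ} {μ : Measure Ω}
  {ν : Measure V} [IsProbabilityMeasure ν] [NullSingletonClass ν] {θ : ℝ}
  {h : Ω → V → Fin J} {X : Fin (m + 2) → Ω → V}

theorem real_bucket_eq (hθ : 0 < θ) (hJ : 1 ≤ J)
    (hZ : ∀ S, MeasurableSet S → μ.real {ω | hashedSample h X ω ∈ S} =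
      (polyaUrn θ (ν.prod (uniformBucket J)) (m + 2)).real S) (c₁ c₂ : ℕ) :
    μ.real {ω | (hashedFreq h X 0 ω = c₁ ∧ hashedFreq h X 1 ω = c₂) ∧
      firstTwo (hashedSample h X ω) ∈ {u | u.1.2 = u.2.2}} =
    posteriorFactor θ m * (if c₁ = c₂ then
      (J : ℝ) * (rising (θ / J) (c₁ + 2) / (c₁.factorial : ℝ)
        * risingOverFactorial (θ - θ / J) ((m : ℤ) - c₁)) else 0) := by
  split_ifs with hc
  -- Since the counts sum to `m`, the bucket count fixes them all. If `c₁ > m` the last entry is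
  -- negative and both sides vanish.
  · set N : Fin 2 → ℤ := ![c₁, m - c₁] with hN
    have hσ : MeasurableSet {u : (V × Fin J) × (V × Fin J) | u.1.2 = u.2.2} :=
      measurableSet_eq_fun (by fun_prop) (by fun_prop)
    have hset : {ω | (hashedFreq h X 0 ω = c₁ ∧ hashedFreq h X 1 ω = c₂) ∧
        firstTwo (hashedSample h X ω) ∈ {u | u.1.2 = u.2.2}} = {ω | hashedSample h X ω ∈
        {z | firstTwo z ∈ {u | u.1.2 = u.2.2} ∧
          ∀ t, (typeCount classifyBucket z t : ℤ) = N t}} := by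
      ext ω
      simp only [Set.mem_ofPred_eq]
      rw [and_comm]
      refine and_congr_right fun hb => ?_
      have hs := sum_typeCount classifyBucket (hashedSample h X ω)
      obtain ⟨h1, h2⟩ := counts_classifyBucket hb
      rw [h1, h2]
      rw [Fin.sum_univ_two] at hs
      simp only [Fin.forall_fin_two, hN, Matrix.cons_val_zero, Matrix.cons_val_one]
      omega
    rw [hset, hZ _ (measurableSet_firstTwo_mem_typeCount_eq
      (fun t => measurable_classifyBucket (measurableSet_singleton t)) hσ N),
      polyaUrn_classifyBucket hθ hJ N (by simp [hN])]
    simp only [hN, Matrix.cons_val_zero, Matrix.cons_val_one, risingOverFactorial_natCast]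
    -- Splitting `(θ/J)(θ/J + 1)` off the rising factorial leaves the weight `θ/J + 2` of the bucket
    -- holding both queries; `J · θ/J` cancels the `θ` in `posteriorFactor`.
    rw [add_comm c₁ 2, rising_add, rising_succ, rising_succ, rising_zero, posteriorFactor]
    push_cast
    field_simp
    ring
  · have hset : {ω | (hashedFreq h X 0 ω = c₁ ∧ hashedFreq h X 1 ω = c₂) ∧
        firstTwo (hashedSample h X ω) ∈ {u | u.1.2 = u.2.2}} = ∅ := by
      ext ω
      simp only [Set.mem_ofPred_eq, Set.mem_empty_iff_false, iff_false]
      rintro ⟨⟨h1, h2⟩, hb⟩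
      obtain ⟨h3, h4⟩ := counts_classifyBucket hb
      omega
    rw [hset, measureReal_empty, mul_zero]

theorem real_bucket_ne (hθ : 0 < θ) (hJ : 1 ≤ J)
    (hZ : ∀ S, MeasurableSet S → μ.real {ω | hashedSample h X ω ∈ S} =
      (polyaUrn θ (ν.prod (uniformBucket J)) (m + 2)).real S) (c₁ c₂ : ℕ) :
    μ.real {ω | (hashedFreq h X 0 ω = c₁ ∧ hashedFreq h X 1 ω = c₂) ∧
      firstTwo (hashedSample h X ω) ∈ {u | u.1.2 ≠ u.2.2}} =
    posteriorFactor θ m * ((J : ℝ) * ((J : ℝ) - 1)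
    * (rising (θ / J) (c₁ + 1) / (c₁.factorial : ℝ)
      * (rising (θ / J) (c₂ + 1) / (c₂.factorial : ℝ))
      * risingOverFactorial (θ - 2 * θ / J) ((m : ℤ) - c₁ - c₂))) := by
  set N : Fin 3 → ℤ := ![c₁, c₂, m - c₁ - c₂] with hN
  have hσ : MeasurableSet {u : (V × Fin J) × (V × Fin J) | u.1.2 ≠ u.2.2} :=
    (measurableSet_eq_fun (by fun_prop) (by fun_prop)).compl
  have hset : {ω | (hashedFreq h X 0 ω = c₁ ∧ hashedFreq h X 1 ω = c₂) ∧
      firstTwo (hashedSample h X ω) ∈ {u | u.1.2 ≠ u.2.2}} = {ω | hashedSample h X ω ∈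
      {z | firstTwo z ∈ {u | u.1.2 ≠ u.2.2} ∧
        ∀ t, (typeCount classifyBuckets z t : ℤ) = N t}} := by
    ext ω
    simp only [Set.mem_ofPred_eq]
    rw [and_comm]
    refine and_congr_right fun hb => ?_
    have hs := sum_typeCount classifyBuckets (hashedSample h X ω)
    obtain ⟨h1, h2⟩ := counts_classifyBuckets hb
    rw [h1, h2]
    rw [Fin.sum_univ_three] at hs
    simp [Fin.forall_fin_succ, hN]
    omega
  rw [hset, hZ _ (measurableSet_firstTwo_mem_typeCount_eq
    (fun t => measurable_classifyBuckets (measurableSet_singleton t)) hσ N),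
    polyaUrn_classifyBuckets hθ hJ N (by simp [hN, Fin.sum_univ_three])]
  simp only [hN, Matrix.cons_val_zero, Matrix.cons_val_one, Matrix.cons_val,
    risingOverFactorial_natCast]
  -- One factor `θ/J` is split off for each query, and `J (J - 1) (θ/J)² = θ² (J - 1)/J`.
  rw [add_comm c₁ 1, add_comm c₂ 1, rising_add, rising_add, rising_succ, rising_zero,
    posteriorFactor]
  push_cast
  field_simp
  ring

theorem real_hashedFreq_eq [IsProbabilityMeasure μ] (hθ : 0 < θ) (hJ : 1 ≤ J)
    (hZm : Measurable (hashedSample h X))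
    (hZ : ∀ S, MeasurableSet S → μ.real {ω | hashedSample h X ω ∈ S} =
      (polyaUrn θ (ν.prod (uniformBucket J)) (m + 2)).real S) (c₁ c₂ : ℕ) :
    μ.real {ω | hashedFreq h X 0 ω = c₁ ∧ hashedFreq h X 1 ω = c₂} =
      posteriorFactor θ m * Den θ J m c₁ c₂ := by
  have hσ : MeasurableSet {u : (V × Fin J) × (V × Fin J) | u.1.2 = u.2.2} :=
    measurableSet_eq_fun (by fun_prop) (by fun_prop)
  rw [← measureReal_inter_add_sdiff (t := {ω | firstTwo (hashedSample h X ω) ∈ _})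
    ((measurable_firstTwo.comp hZm) hσ), Den, mul_add, ← real_bucket_eq hθ hJ hZ,
    ← real_bucket_ne hθ hJ hZ]
  rfl

variable [MeasurableEq V]

theorem real_sample_eq (hθ : 0 < θ) (hJ : 1 ≤ J)
    (hZ : ∀ S, MeasurableSet S → μ.real {ω | hashedSample h X ω ∈ S} =
      (polyaUrn θ (ν.prod (uniformBucket J)) (m + 2)).real S) (l₁ l₂ c₁ c₂ : ℕ) :
    μ.real {ω | ((hashedFreq h X 0 ω = c₁ ∧ hashedFreq h X 1 ω = c₂) ∧
      freq X 0 ω = l₁ ∧ freq X 1 ω = l₂) ∧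
      firstTwo (hashedSample h X ω) ∈ {u | u.1.1 = u.2.1}} =
    posteriorFactor θ m * (if l₁ = l₂ ∧ c₁ = c₂ then
      θ * ((l₁ : ℝ) + 1) * risingOverFactorial (θ / J) ((c₁ : ℤ) - l₁)
        * risingOverFactorial (θ - θ / J) ((m : ℤ) - c₁) else 0) := by
  split_ifs with hc
  · set N : Fin 3 → ℤ := ![l₁, c₁ - l₁, m - c₁] with hN
    have hσ : MeasurableSet {u : (V × Fin J) × (V × Fin J) | u.1.1 = u.2.1} :=
      measurableSet_eq_fun (by fun_prop) (by fun_prop)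
    have hset : {ω | ((hashedFreq h X 0 ω = c₁ ∧ hashedFreq h X 1 ω = c₂) ∧
        freq X 0 ω = l₁ ∧ freq X 1 ω = l₂) ∧
        firstTwo (hashedSample h X ω) ∈ {u | u.1.1 = u.2.1}} = {ω | hashedSample h X ω ∈
        {z | firstTwo z ∈ {u | u.1.1 = u.2.1} ∧
          ∀ t, (typeCount classifyEq z t : ℤ) = N t}} := by
      ext ω
      simp only [Set.mem_ofPred_eq]
      rw [and_comm]
      refine and_congr_right fun hb => ?_
      have hs := sum_typeCount classifyEq (hashedSample h X ω)
      obtain ⟨h1, h2, h3, h4⟩ := counts_classifyEq hb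
      rw [h1, h2, h3, h4]
      rw [Fin.sum_univ_three] at hs
      simp [Fin.forall_fin_succ, hN]
      omega
    rw [hset, hZ _ (measurableSet_firstTwo_mem_typeCount_eq
      (fun t => measurable_classifyEq (measurableSet_singleton t)) hσ N),
      polyaUrn_classifyEq hθ hJ N (by simp [hN, Fin.sum_univ_three])]
    simp only [hN, Matrix.cons_val_zero, Matrix.cons_val_one, Matrix.cons_val,
      risingOverFactorial_two]
    rw [posteriorFactor]
    field_simp
  · have hset : {ω | ((hashedFreq h X 0 ω = c₁ ∧ hashedFreq h X 1 ω = c₂) ∧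
        freq X 0 ω = l₁ ∧ freq X 1 ω = l₂) ∧
        firstTwo (hashedSample h X ω) ∈ {u | u.1.1 = u.2.1}} = ∅ := by
      ext ω
      simp only [Set.mem_ofPred_eq, Set.mem_empty_iff_false, iff_false]
      rintro ⟨⟨⟨h1, h2⟩, h3, h4⟩, hb⟩
      obtain ⟨h5, h6, h7, h8⟩ := counts_classifyEq hb
      omega
    rw [hset, measureReal_empty, mul_zero]

theorem real_sample_ne_bucket_eq (hθ : 0 < θ) (hJ : 1 ≤ J)
    (hZ : ∀ S, MeasurableSet S → μ.real {ω | hashedSample h X ω ∈ S} =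
      (polyaUrn θ (ν.prod (uniformBucket J)) (m + 2)).real S) (l₁ l₂ c₁ c₂ : ℕ) :
    μ.real {ω | ((hashedFreq h X 0 ω = c₁ ∧ hashedFreq h X 1 ω = c₂) ∧
      freq X 0 ω = l₁ ∧ freq X 1 ω = l₂) ∧
      firstTwo (hashedSample h X ω) ∈ {u | u.1.1 ≠ u.2.1 ∧ u.1.2 = u.2.2}} =
    posteriorFactor θ m * (if c₁ = c₂ then
      θ ^ 2 / (J : ℝ) * risingOverFactorial (θ / J) ((c₁ : ℤ) - l₁ - l₂)
        * risingOverFactorial (θ - θ / J) ((m : ℤ) - c₁) else 0) := by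
  split_ifs with hc
  · set N : Fin 4 → ℤ := ![l₁, l₂, c₁ - l₁ - l₂, m - c₁] with hN
    have hσ : MeasurableSet {u : (V × Fin J) × (V × Fin J) | u.1.1 ≠ u.2.1 ∧ u.1.2 = u.2.2} :=
      (measurableSet_eq_fun (by fun_prop) (by fun_prop)).compl.inter
        (measurableSet_eq_fun (by fun_prop) (by fun_prop))
    have hset : {ω | ((hashedFreq h X 0 ω = c₁ ∧ hashedFreq h X 1 ω = c₂) ∧
        freq X 0 ω = l₁ ∧ freq X 1 ω = l₂) ∧
        firstTwo (hashedSample h X ω) ∈ {u | u.1.1 ≠ u.2.1 ∧ u.1.2 = u.2.2}} =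
        {ω | hashedSample h X ω ∈ {z | firstTwo z ∈ {u | u.1.1 ≠ u.2.1 ∧ u.1.2 = u.2.2} ∧
          ∀ t, (typeCount classifySame z t : ℤ) = N t}} := by
      ext ω
      simp only [Set.mem_ofPred_eq]
      rw [and_comm]
      refine and_congr_right fun hb => ?_
      have hs := sum_typeCount classifySame (hashedSample h X ω)
      obtain ⟨h1, h2, h3, h4⟩ := counts_classifySame hb.1 hb.2
      rw [h1, h2, h3, h4]
      rw [Fin.sum_univ_four] at hs
      simp [Fin.forall_fin_succ, hN]
      omega
    rw [hset, hZ _ (measurableSet_firstTwo_mem_typeCount_eq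
      (fun t => measurable_classifySame (measurableSet_singleton t)) hσ N),
      polyaUrn_classifySame hθ hJ N (by simp [hN, Fin.sum_univ_four])]
    simp only [hN, Matrix.cons_val_zero, Matrix.cons_val_one, Matrix.cons_val,
      risingOverFactorial_one]
    rw [posteriorFactor]
    field_simp
  · have hset : {ω | ((hashedFreq h X 0 ω = c₁ ∧ hashedFreq h X 1 ω = c₂) ∧
        freq X 0 ω = l₁ ∧ freq X 1 ω = l₂) ∧
        firstTwo (hashedSample h X ω) ∈ {u | u.1.1 ≠ u.2.1 ∧ u.1.2 = u.2.2}} = ∅ := by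
      ext ω
      simp only [Set.mem_ofPred_eq, Set.mem_empty_iff_false, iff_false]
      rintro ⟨⟨⟨h1, h2⟩, h3, h4⟩, hb⟩
      obtain ⟨h5, h6, h7, h8⟩ := counts_classifySame hb.1 hb.2
      omega
    rw [hset, measureReal_empty, mul_zero]

theorem real_sample_ne_bucket_ne (hθ : 0 < θ) (hJ : 1 ≤ J)
    (hZ : ∀ S, MeasurableSet S → μ.real {ω | hashedSample h X ω ∈ S} =
      (polyaUrn θ (ν.prod (uniformBucket J)) (m + 2)).real S) (l₁ l₂ c₁ c₂ : ℕ) :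
    μ.real {ω | ((hashedFreq h X 0 ω = c₁ ∧ hashedFreq h X 1 ω = c₂) ∧
      freq X 0 ω = l₁ ∧ freq X 1 ω = l₂) ∧
      firstTwo (hashedSample h X ω) ∈ {u | u.1.1 ≠ u.2.1 ∧ u.1.2 ≠ u.2.2}} =
    posteriorFactor θ m * (((J : ℝ) - 1) / (J : ℝ) * (θ ^ 2
      * risingOverFactorial (θ / J) ((c₁ : ℤ) - l₁)
      * risingOverFactorial (θ / J) ((c₂ : ℤ) - l₂)
      * risingOverFactorial (θ - 2 * θ / J) ((m : ℤ) - c₁ - c₂))) := by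
  set N : Fin 5 → ℤ := ![l₁, l₂, c₁ - l₁, c₂ - l₂, m - c₁ - c₂] with hN
  have hσ : MeasurableSet {u : (V × Fin J) × (V × Fin J) | u.1.1 ≠ u.2.1 ∧ u.1.2 ≠ u.2.2} :=
    (measurableSet_eq_fun (by fun_prop) (by fun_prop)).compl.inter
      (measurableSet_eq_fun (by fun_prop) (by fun_prop)).compl
  have hset : {ω | ((hashedFreq h X 0 ω = c₁ ∧ hashedFreq h X 1 ω = c₂) ∧
      freq X 0 ω = l₁ ∧ freq X 1 ω = l₂) ∧
      firstTwo (hashedSample h X ω) ∈ {u | u.1.1 ≠ u.2.1 ∧ u.1.2 ≠ u.2.2}} =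
      {ω | hashedSample h X ω ∈ {z | firstTwo z ∈ {u | u.1.1 ≠ u.2.1 ∧ u.1.2 ≠ u.2.2} ∧
        ∀ t, (typeCount classifyDiff z t : ℤ) = N t}} := by
    ext ω
    simp only [Set.mem_ofPred_eq]
    rw [and_comm]
    refine and_congr_right fun hb => ?_
    have hs := sum_typeCount classifyDiff (hashedSample h X ω)
    obtain ⟨h1, h2, h3, h4⟩ := counts_classifyDiff hb.2
    rw [h1, h2, h3, h4]
    rw [Fin.sum_univ_five] at hs
    simp [Fin.forall_fin_succ, hN]
    omega
  rw [hset, hZ _ (measurableSet_firstTwo_mem_typeCount_eq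
    (fun t => measurable_classifyDiff (measurableSet_singleton t)) hσ N),
    polyaUrn_classifyDiff hθ hJ N (by simp [hN, Fin.sum_univ_five]; ring)]
  simp only [hN, Matrix.cons_val_zero, Matrix.cons_val_one, Matrix.cons_val,
    risingOverFactorial_one]
  rw [posteriorFactor]
  field_simp

theorem real_hashedFreq_freq_eq [IsProbabilityMeasure μ] (hθ : 0 < θ) (hJ : 1 ≤ J)
    (hZm : Measurable (hashedSample h X))
    (hZ : ∀ S, MeasurableSet S → μ.real {ω | hashedSample h X ω ∈ S} =
      (polyaUrn θ (ν.prod (uniformBucket J)) (m + 2)).real S) (l₁ l₂ c₁ c₂ : ℕ) :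
    μ.real {ω | (hashedFreq h X 0 ω = c₁ ∧ hashedFreq h X 1 ω = c₂) ∧
      freq X 0 ω = l₁ ∧ freq X 1 ω = l₂} =
      posteriorFactor θ m * Num θ J m l₁ l₂ c₁ c₂ := by
  have hσx : MeasurableSet {u : (V × Fin J) × (V × Fin J) | u.1.1 = u.2.1} :=
    measurableSet_eq_fun (by fun_prop) (by fun_prop)
  have hσb : MeasurableSet {u : (V × Fin J) × (V × Fin J) | u.1.2 = u.2.2} :=
    measurableSet_eq_fun (by fun_prop) (by fun_prop)
  -- Split by equality of the query values, then split the unequal case by equality of the buckets;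
  -- the three pieces are the three summands of `Num`.
  rw [← measureReal_inter_add_sdiff (t := {ω | firstTwo (hashedSample h X ω) ∈ _})
    ((measurable_firstTwo.comp hZm) hσx), ← measureReal_inter_add_sdiff
    (s := _ \ _) (t := {ω | firstTwo (hashedSample h X ω) ∈ _})
    ((measurable_firstTwo.comp hZm) hσb), Num, mul_add, mul_add, ← real_sample_eq hθ hJ hZ,
    ← real_sample_ne_bucket_eq hθ hJ hZ, ← real_sample_ne_bucket_ne hθ hJ hZ, add_assoc]
  congr 2
  · congr 1
    ext ω
    exact and_assoc
  · congr 1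
    ext ω
    exact and_assoc

end JointLaw

end RangeQuery

theorem theorem3 {Ω V : Type*} [MeasurableSpace Ω] [MeasurableSpace V] [MeasurableEq V]
    (μ : Measure Ω) [IsProbabilityMeasure μ]
    (ν : Measure V) [IsProbabilityMeasure ν] [NullSingletonClass ν]
    (θ : ℝ) (hθ : 0 < θ) (m J : ℕ) (hm : 1 ≤ m) (hJ : 1 ≤ J)
    (P : Ω → Measure V) (hP : μ.map P = RangeQuery.dirichletProcess θ ν)
    (X : Fin (m + 2) → Ω → V) (hX : RangeQuery.IsSampleFrom μ P X)
    (h : Ω → V → Fin J) (hh : RangeQuery.IsPerfectlyRandomHash μ h)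
    (hhX : RangeQuery.IsDrawnIndependently μ h X)
    (c₁ c₂ : ℕ) :
    (μ {ω | RangeQuery.hashedFreq h X 0 ω = c₁ ∧ RangeQuery.hashedFreq h X 1 ω = c₂} ≠ 0 ↔
      0 < RangeQuery.Den θ J m c₁ c₂) ∧
    (0 < RangeQuery.Den θ J m c₁ c₂ → ∀ l₁ l₂ : ℕ,
      (cond μ {ω | RangeQuery.hashedFreq h X 0 ω = c₁ ∧ RangeQuery.hashedFreq h X 1 ω = c₂}).real
          {ω | RangeQuery.freq X 0 ω = l₁ ∧ RangeQuery.freq X 1 ω = l₂} =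
        RangeQuery.Num θ J m l₁ l₂ c₁ c₂ / RangeQuery.Den θ J m c₁ c₂) := by
  have hZm : Measurable (RangeQuery.hashedSample h X) :=
    measurable_pi_iff.2 fun i => (hX.measurable i).prodMk (hhX.measurable i)
  have hZ : ∀ S, MeasurableSet S → μ.real {ω | RangeQuery.hashedSample h X ω ∈ S} =
      (RangeQuery.polyaUrn θ (ν.prod (RangeQuery.uniformBucket J)) (m + 2)).real S := by
    intro S hS
    rw [← hhX.map_eq_polyaUrn hh hJ hθ hP hX]
    exact (map_measureReal_apply hZm hS).symm
  have hK := RangeQuery.posteriorFactor_pos hθ m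
  have hDen := RangeQuery.real_hashedFreq_eq hθ hJ hZm hZ c₁ c₂
  have hCm : ∀ r, Measurable (RangeQuery.hashedFreq h X r) := by
    intro r
    unfold RangeQuery.hashedFreq
    simp only [Finset.card_filter]
    exact Finset.measurable_fun_sum _ fun i _ => Measurable.ite
      (measurableSet_eq_fun (hhX.measurable _) (hhX.measurable _)) measurable_const
      measurable_const
  have hC : MeasurableSet {ω | RangeQuery.hashedFreq h X 0 ω = c₁ ∧ RangeQuery.hashedFreq h X 1 ω = c₂} :=
    (hCm 0 (measurableSet_singleton c₁)).inter (hCm 1 (measurableSet_singleton c₂))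
  constructor
  · have hnn : 0 ≤ RangeQuery.posteriorFactor θ m * RangeQuery.Den θ J m c₁ c₂ := by
      rw [← hDen]; positivity
    -- A positive multiple of `Den` is a probability, so `Den` is nonnegative and being nonzero
    -- means being positive.
    rw [← measureReal_ne_zero_iff (measure_ne_top _ _), hDen, ← hnn.lt_iff_ne',
      mul_pos_iff_of_pos_left hK]
  · intro hD l₁ l₂
    -- The conditional probability is a quotient of the two joint laws, in which `posteriorFactor θ
    -- m` cancels.
    rw [Measure.real, cond_apply hC, ENNReal.toReal_mul, ENNReal.toReal_inv]
    change (μ.real _)⁻¹ * μ.real _ = _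
    rw [hDen, Set.inter_def]
    have hNum := RangeQuery.real_hashedFreq_freq_eq hθ hJ hZm hZ l₁ l₂ c₁ c₂
    simp only [Set.mem_ofPred_eq]
    rw [hNum]
    field_simp
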